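/- **Definitions.** A *zroupoid* is an algebra $\langle A,\to,0\rangle$ with a binary operation $\to$ and a constant $0$; write $x':=x\to 0$ and $x\wedge y:=(x\to y')'$. Let $\mathcal I$ be the variety of zroupoids satisfying $(x\to y)\to z\approx((z'\to x)\to(y\to z)')'$ and $0''\approx 0$; let $\mathcal S$ be the subvariety of $\mathcal I$ defined by $x''\approx x$ and $x\wedge y\approx y\wedge x$, and $\mathcal{SL}$ the subvariety of $\mathcal I$ defined by $x'\approx x$ and $x\to y\approx y\to x$. A *weak associative law of length $n$* is an identity $s\approx t$ between two terms in variables and $\to$, where $s$ and $t$ each have $n$ occurrences of variables and contain the same variables in the same order (only the bracketing may differ). The brackettings of a word of length $3$ are numbered 1: $a\to(a\to a)$, 2: $(a\to a)\to a$; those of a word of length $4$ are numbered 1: $a\to(a\to(a\to a))$, 2: $a\to((a\to a)\to a)$, 3: $(a\to a)\to(a\to a)$, 4: $(a\to(a\to a))\to a$, 5: $((a\to a)\to a)\to a$ (here $a$ is a place holder). Words of length $1$ and $2$ have a single bracketing. The words of length $3$ and $4$ whose variables occur alphabetically are - $31\mathrm A=xxx$; $32\mathrm A=xxy$, $32\mathrm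 B=xyx$, $32\mathrm C=xyy$; $33\mathrm A=xyz$; - $41\mathrm A=xxxx$; $42\mathrm A=xxxy$, $42\mathrm B=xxyx$, $42\mathrm C=xxyy$, $42\mathrm D=xyxx$, $42\mathrm E=xyxy$, $42\mathrm F=xyyx$, $42\mathrm G=xyyy$; - $43\mathrm A=xxyz$, $43\mathrm B=xyxz$, $43\mathrm C=xyyz$, $43\mathrm D=xyzx$, $43\mathrm E=xyzy$, $43\mathrm F=xyzz$; $44\mathrm A=txyz$. For such a word $nm\mathrm X$ (of length $n$, with $m$ distinct variables) and bracketing numbers $p<q$, $(nm\mathrm Xpq)$ is the identity between the terms obtained from the word by brackettings $p$ and $q$, and $nm\mathcal Xpq$ is the variety defined by it relative to $\mathcal S$ (the class of all members of $\mathcal S$ that satisfy it). **Proposition.** Every variety defined relative to $\mathcal S$ by a weak associative law of length $\le 4$ is equal to one of $$\mathcal{SL},\quad 43\mathcal A12,\quad 43\mathcal A23,\quad 42\mathcal A12,\quad 43\mathcal F25,\quad \mathcal S.$$ There are exactly $155$ laws $(nm\mathrm Xpq)$ of length at most $4$ with $p<q$, and they are partitioned into the following six blocks, where every law in a block defines,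 relative to $\mathcal S$, the variety that heads the block. (In each block, the word is followed by the pairs $pq$; the number of laws is in parentheses.) - $\mathcal{SL}$ (91): $32\mathrm{A}$: $12$; $32\mathrm{B}$: $12$; $32\mathrm{C}$: $12$; $33\mathrm{A}$: $12$; $42\mathrm{A}$: $14$; $42\mathrm{B}$: $14$, $24$, $34$, $45$; $42\mathrm{C}$: $14$, $24$, $34$, $45$; $42\mathrm{D}$: $14$, $34$; $42\mathrm{E}$: $12$, $14$, $15$, $23$, $24$, $34$, $35$, $45$; $42\mathrm{F}$: $13$, $14$, $15$, $23$, $24$, $34$, $45$; $42\mathrm{G}$: $14$, $23$, $24$, $35$, $45$; $43\mathrm{A}$: $13$, $14$, $15$, $24$, $34$, $45$; $43\mathrm{B}$: $12$, $14$, $15$, $23$, $24$, $34$, $35$, $45$; $43\mathrm{C}$: $12$, $13$, $14$, $15$, $23$, $24$, $34$, $35$, $45$; $43\mathrm{D}$: $13$, $14$, $15$, $23$, $24$, $34$, $45$; $43\mathrm{E}$: $12$, $13$, $14$, $15$, $23$, $24$, $34$, $35$, $45$; $43\mathrm{F}$: $12$, $14$, $15$, $23$, $24$, $34$, $35$, $45$;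 $44\mathrm{A}$: $12$, $13$, $14$, $15$, $23$, $24$, $34$, $35$, $45$. - $43\mathcal A12$ (14): $42\mathrm{C}$: $12$, $13$, $15$; $42\mathrm{D}$: $12$, $15$; $42\mathrm{E}$: $13$; $42\mathrm{F}$: $12$, $35$; $42\mathrm{G}$: $13$; $43\mathrm{A}$: $12$; $43\mathrm{B}$: $13$; $43\mathrm{D}$: $12$, $35$; $43\mathrm{F}$: $13$. - $43\mathcal A23$ (24): $31\mathrm{A}$: $12$; $41\mathrm{A}$: $14$, $24$, $34$, $45$; $42\mathrm{A}$: $24$, $34$, $45$; $42\mathrm{B}$: $13$, $15$, $23$, $25$; $42\mathrm{D}$: $24$, $45$; $42\mathrm{F}$: $25$; $42\mathrm{G}$: $12$, $15$, $34$; $43\mathrm{A}$: $23$, $25$; $43\mathrm{C}$: $25$; $43\mathrm{D}$: $25$; $43\mathrm{E}$: $25$; $44\mathrm{A}$: $25$. - $42\mathcal A12$ (5): $42\mathrm{A}$: $12$, $13$, $15$; $42\mathrm{D}$: $23$, $35$. - $43\mathcal F25$ (9): $42\mathrm{B}$: $12$, $35$; $42\mathrm{C}$: $23$, $25$, $35$;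 $42\mathrm{D}$: $13$; $42\mathrm{G}$: $25$; $43\mathrm{A}$: $35$; $43\mathrm{F}$: $25$. - $\mathcal S$ (12): $41\mathrm{A}$: $12$, $13$, $15$, $23$, $25$, $35$; $42\mathrm{A}$: $23$, $25$, $35$; $42\mathrm{D}$: $25$; $42\mathrm{E}$: $25$; $43\mathrm{B}$: $25$. -/

import Mathlib

universe u

namespace WeakAssoc

/-- A zroupoid: an algebra with a binary operation `imp` (written `→` in the literature)
and a constant `zero`. -/
structure Zroupoid where
  carrier : Type u
  imp : carrier → carrier → carrier
  zero : carrier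

namespace Zroupoid

/-- `x' := x → 0`. -/
def neg (A : Zroupoid.{u}) (x : A.carrier) : A.carrier := A.imp x A.zero

/-- `x ∧ y := (x → y')'`. -/
def meet (A : Zroupoid.{u}) (x y : A.carrier) : A.carrier := A.neg (A.imp x (A.neg y))

/-- The value of a groupoid term in the variables `0, 1, 2, …`, the operation symbol being
interpreted by `imp`. -/
def eval (A : Zroupoid.{u}) (v : ℕ → A.carrier) : FreeMagma ℕ → A.carrier
  | .of i => v i
  | .mul s t => A.imp (A.eval v s) (A.eval v t)

/-- `A` satisfies the identity `s ≈ t`. -/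
def Satisfies (A : Zroupoid.{u}) (s t : FreeMagma ℕ) : Prop :=
  ∀ v : ℕ → A.carrier, A.eval v s = A.eval v t

end Zroupoid

/-- The variety of implication zroupoids:
`(x → y) → z ≈ ((z' → x) → (y → z)')'` and `0'' ≈ 0`. -/
def varietyI : Set Zroupoid.{u} :=
  {A | (∀ x y z : A.carrier, A.imp (A.imp x y) z =
          A.neg (A.imp (A.imp (A.neg z) x) (A.neg (A.imp y z)))) ∧
       A.neg (A.neg A.zero) = A.zero}

/-- The variety of symmetric implication zroupoids: those implication zroupoids that are
involutive (`x'' ≈ x`) and meet-commutative (`x ∧ y ≈ y ∧ x`). -/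
def varietyS : Set Zroupoid.{u} :=
  {A | A ∈ varietyI ∧ (∀ x : A.carrier, A.neg (A.neg x) = x) ∧
       ∀ x y : A.carrier, A.meet x y = A.meet y x}

/-- The variety `SL`, defined relative to implication zroupoids by `x' ≈ x` and
`x → y ≈ y → x`. -/
def varietySL : Set Zroupoid.{u} :=
  {A | A ∈ varietyI ∧ (∀ x : A.carrier, A.neg x = x) ∧
       ∀ x y : A.carrier, A.imp x y = A.imp y x}

/-- The word of variables of a term, read from left to right. -/
def letters : FreeMagma ℕ → List ℕ
  | .of i => [i]
  | .mul s t => letters s ++ letters t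

/-- `s ≈ t` is a weak associative law of length `n`: the terms `s` and `t` have length `n`, and
the same variables occur in the same order in both. -/
def IsWeakAssocLaw (n : ℕ) (s t : FreeMagma ℕ) : Prop :=
  (letters s).length = n ∧ letters s = letters t

/-- The variety defined, relative to `varietyS`, by the identity `s ≈ t`. -/
def variety (s t : FreeMagma ℕ) : Set Zroupoid.{u} :=
  {A | A ∈ varietyS ∧ A.Satisfies s t}

/-- `bracketing w p` is the term obtained from the word `w` of length at most `4` by the
bracketing with number `p`; it is `none` if there is no such bracketing. -/
def bracketing : List ℕ → ℕ → Option (FreeMagma ℕ)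
  | [a], 1 => some (.of a)
  | [a, b], 1 => some (.of a * .of b)
  | [a, b, c], 1 => some (.of a * (.of b * .of c))
  | [a, b, c], 2 => some ((.of a * .of b) * .of c)
  | [a, b, c, d], 1 => some (.of a * (.of b * (.of c * .of d)))
  | [a, b, c, d], 2 => some (.of a * ((.of b * .of c) * .of d))
  | [a, b, c, d], 3 => some ((.of a * .of b) * (.of c * .of d))
  | [a, b, c, d], 4 => some ((.of a * (.of b * .of c)) * .of d)
  | [a, b, c, d], 5 => some (((.of a * .of b) * .of c) * .of d)
  | _, _ => none

/-- The variables of `w` occur alphabetically: before a variable occurs, all the variables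
that precede it in the alphabet `0, 1, 2, …` have occurred. -/
def Alphabetical (w : List ℕ) : Prop :=
  ∀ (i : ℕ) (hi : i < w.length), ∀ a < w[i], a ∈ w.take i

/-- The name `(w, p, q)` of a law: a word and two bracketing numbers. -/
abbrev LawName : Type := List ℕ × ℕ × ℕ

/-- The names of the (nontrivial) weak associative laws of length at most `4`: the variables of
the word occur alphabetically, and `p < q` are two bracketing numbers of that word. -/
def weakLaws : Set LawName :=
  {l | l.1.length ≤ 4 ∧ Alphabetical l.1 ∧ l.2.1 < l.2.2 ∧
       (bracketing l.1 l.2.1).isSome ∧ (bracketing l.1 l.2.2).isSome}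

/-- The variety defined, relative to `varietyS`, by the law with the name `(w, p, q)`
(empty if `p` or `q` is not the number of a bracketing of `w`). -/
def lawVariety (l : LawName) : Set Zroupoid.{u} :=
  {A | ∃ s t : FreeMagma ℕ, bracketing l.1 l.2.1 = some s ∧ bracketing l.1 l.2.2 = some t ∧
       A ∈ variety s t}

/- The words of length `3` and `4`: the first digit is the length, the second one is the number
of distinct variables. The words of length `3` with two variables give the left-alternative law
(`w32A`), the flexible law (`w32B`) and the right-alternative law (`w32C`). -/

def w31A : List ℕ := [0, 0, 0]
def w32A : List ℕ := [0, 0, 1]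
def w32B : List ℕ := [0, 1, 0]
def w32C : List ℕ := [0, 1, 1]
def w33A : List ℕ := [0, 1, 2]
def w41A : List ℕ := [0, 0, 0, 0]
def w42A : List ℕ := [0, 0, 0, 1]
def w42B : List ℕ := [0, 0, 1, 0]
def w42C : List ℕ := [0, 0, 1, 1]
def w42D : List ℕ := [0, 1, 0, 0]
def w42E : List ℕ := [0, 1, 0, 1]
def w42F : List ℕ := [0, 1, 1, 0]
def w42G : List ℕ := [0, 1, 1, 1]
def w43A : List ℕ := [0, 0, 1, 2]
def w43B : List ℕ := [0, 1, 0, 2]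
def w43C : List ℕ := [0, 1, 1, 2]
def w43D : List ℕ := [0, 1, 2, 0]
def w43E : List ℕ := [0, 1, 2, 1]
def w43F : List ℕ := [0, 1, 2, 2]
def w44A : List ℕ := [0, 1, 2, 3]

/-- The laws given by a word and a list of pairs of bracketing numbers. -/
def laws (w : List ℕ) (ps : List (ℕ × ℕ)) : List LawName := ps.map fun pq => (w, pq)

/-- Labels of the six blocks. -/
inductive Block where
  | sl
  | a43A12
  | a43A23
  | a42A12
  | a43F25
  | s

/-- The variety that represents a block. -/
def Block.rep : Block → Set Zroupoid.{u}
  | .sl => varietySL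
  | .a43A12 => lawVariety (w43A, 1, 2)
  | .a43A23 => lawVariety (w43A, 2, 3)
  | .a42A12 => lawVariety (w42A, 1, 2)
  | .a43F25 => lawVariety (w43F, 2, 5)
  | .s => varietyS

/-- The laws in each of the six blocks. -/
def Block.members : Block → List LawName
  | .sl =>
      laws w32A [(1, 2)] ++
      laws w32B [(1, 2)] ++
      laws w32C [(1, 2)] ++
      laws w33A [(1, 2)] ++
      laws w42A [(1, 4)] ++
      laws w42B [(1, 4), (2, 4), (3, 4), (4, 5)] ++
      laws w42C [(1, 4), (2, 4), (3, 4), (4, 5)] ++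
      laws w42D [(1, 4), (3, 4)] ++
      laws w42E [(1, 2), (1, 4), (1, 5), (2, 3), (2, 4), (3, 4), (3, 5), (4, 5)] ++
      laws w42F [(1, 3), (1, 4), (1, 5), (2, 3), (2, 4), (3, 4), (4, 5)] ++
      laws w42G [(1, 4), (2, 3), (2, 4), (3, 5), (4, 5)] ++
      laws w43A [(1, 3), (1, 4), (1, 5), (2, 4), (3, 4), (4, 5)] ++
      laws w43B [(1, 2), (1, 4), (1, 5), (2, 3), (2, 4), (3, 4), (3, 5), (4, 5)] ++
      laws w43C [(1, 2), (1, 3), (1, 4), (1, 5), (2, 3), (2, 4), (3, 4), (3, 5), (4, 5)] ++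
      laws w43D [(1, 3), (1, 4), (1, 5), (2, 3), (2, 4), (3, 4), (4, 5)] ++
      laws w43E [(1, 2), (1, 3), (1, 4), (1, 5), (2, 3), (2, 4), (3, 4), (3, 5), (4, 5)] ++
      laws w43F [(1, 2), (1, 4), (1, 5), (2, 3), (2, 4), (3, 4), (3, 5), (4, 5)] ++
      laws w44A [(1, 2), (1, 3), (1, 4), (1, 5), (2, 3), (2, 4), (3, 4), (3, 5), (4, 5)]
  | .a43A12 =>
      laws w42C [(1, 2), (1, 3), (1, 5)] ++
      laws w42D [(1, 2), (1, 5)] ++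
      laws w42E [(1, 3)] ++
      laws w42F [(1, 2), (3, 5)] ++
      laws w42G [(1, 3)] ++
      laws w43A [(1, 2)] ++
      laws w43B [(1, 3)] ++
      laws w43D [(1, 2), (3, 5)] ++
      laws w43F [(1, 3)]
  | .a43A23 =>
      laws w31A [(1, 2)] ++
      laws w41A [(1, 4), (2, 4), (3, 4), (4, 5)] ++
      laws w42A [(2, 4), (3, 4), (4, 5)] ++
      laws w42B [(1, 3), (1, 5), (2, 3), (2, 5)] ++
      laws w42D [(2, 4), (4, 5)] ++
      laws w42F [(2, 5)] ++
      laws w42G [(1, 2), (1, 5), (3, 4)] ++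
      laws w43A [(2, 3), (2, 5)] ++
      laws w43C [(2, 5)] ++
      laws w43D [(2, 5)] ++
      laws w43E [(2, 5)] ++
      laws w44A [(2, 5)]
  | .a42A12 =>
      laws w42A [(1, 2), (1, 3), (1, 5)] ++
      laws w42D [(2, 3), (3, 5)]
  | .a43F25 =>
      laws w42B [(1, 2), (3, 5)] ++
      laws w42C [(2, 3), (2, 5), (3, 5)] ++
      laws w42D [(1, 3)] ++
      laws w42G [(2, 5)] ++
      laws w43A [(3, 5)] ++
      laws w43F [(2, 5)]
  | .s =>
      laws w41A [(1, 2), (1, 3), (1, 5), (2, 3), (2, 5), (3, 5)] ++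
      laws w42A [(2, 3), (2, 5), (3, 5)] ++
      laws w42D [(2, 5)] ++
      laws w42E [(2, 5)] ++
      laws w43B [(2, 5)]

end WeakAssoc

/-!
Put `1 = 0'`, `x ⊓ y = x ∧ y` and `x ⊔ y = x' → y`. In a symmetric implication zroupoid `'` is then
a De Morgan involution, `x → y = x' ⊔ y`, and the identity for `(x → y) → z` says exactly that `⊔`
distributes over `⊓`. So the members of `varietyS` are commutative algebras with units, an
involution and both distributive laws. Idempotence and associativity follow
(`DistribBisemilattice.inf_self`, `DistribBisemilattice.inf_assoc`), but absorption does not: such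
an algebra is a Płonka sum of distributive lattices, and `x ◁ y = x ⊔ 0 ⊓ y = x ⊓ (x ⊔ y)` moves `x`
to the fibre of `x` and `y`. The involution may permute the fibres.

Pushing negations to the variables turns a groupoid term into a lattice term in the literals `x`,
`x'`. Such a term has a Shannon expansion, up to a shift by the literal expanded
(`LatTerm.eval_shift_eq`); if the literal occurs in the term the shift changes nothing. Hence an
identity holds in all of `varietyS` when its two sides have the same literals and the same truth
values under all assignments to the literals. Three conditions measure how this may fail for a law
whose two sides have the same variables:

* the sides have different literals; substituting `0` for the other variables, such a law forces
  `x ◁ x' = x` (`ComplFibrewise`), after which `x` and `x'` count as the same literal;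
* the sides differ at a classical assignment, which forces `0 = 1` and makes `⊓` and `⊔` equal;
* the sides differ at an assignment that makes both literals of some variables false; this forces
  `x ⊔ x'` to be the top of its fibre (`IsComplemented`), after which only classical assignments
  matter (`LatTerm.eval_shift_shift_eq`).

Conversely these conditions imply the law (`impEval_eq_of_holds`), provided that assignments with
both literals of a variable true detect nothing more, which is a finite check for each of the laws.
So the variety of a law is determined by three truth values, its `Profile`. Since the second
condition implies the third, six profiles are possible, and they correspond to the six blocks; the
block of each law is found by computation. An arbitrary law is reduced to a listed one by an
injective renaming of its variables.
-/

namespace WeakAssoc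

/-! ### Bounded distributive bisemilattices -/

/-- Two commutative operations `⊓` and `⊔` with units `1` and `0`, each of which distributes over
the other. There is no absorption law: `x ⊓ (x ⊔ y)` may differ from `x`. Idempotence and
associativity are not assumed, since they follow (`inf_self`, `inf_assoc`). -/
class DistribBisemilattice (α : Type*) extends Min α, Max α, Zero α, One α where
  inf_comm (x y : α) : x ⊓ y = y ⊓ x
  sup_comm (x y : α) : x ⊔ y = y ⊔ x
  inf_one (x : α) : x ⊓ 1 = x
  sup_zero (x : α) : x ⊔ 0 = x
  inf_sup (x y z : α) : x ⊓ (y ⊔ z) = x ⊓ y ⊔ x ⊓ z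
  sup_inf (x y z : α) : x ⊔ y ⊓ z = (x ⊔ y) ⊓ (x ⊔ z)

namespace DistribBisemilattice

section

variable {α : Type*} [DistribBisemilattice α]

/-- The same carrier with the two operations interchanged. -/
abbrev dual (α : Type*) [DistribBisemilattice α] : DistribBisemilattice α where
  min x y := x ⊔ y
  max x y := x ⊓ y
  zero := 1
  one := 0
  inf_comm := sup_comm
  sup_comm := inf_comm
  inf_one := sup_zero
  sup_zero := inf_one
  inf_sup := sup_inf
  sup_inf := inf_sup

theorem zero_sup (x : α) : 0 ⊔ x = x := by rw [sup_comm, sup_zero]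

theorem one_inf (x : α) : 1 ⊓ x = x := by rw [inf_comm, inf_one]

theorem sup_inf_right (x y z : α) : x ⊓ y ⊔ z = (x ⊔ z) ⊓ (y ⊔ z) := by
  rw [sup_comm, sup_inf, sup_comm z, sup_comm z]

theorem inf_sup_right (x y z : α) : (x ⊔ y) ⊓ z = x ⊓ z ⊔ y ⊓ z :=
  @sup_inf_right α (dual α) x y z

theorem one_sup_one : (1 : α) ⊔ 1 = 1 := by
  have h := sup_inf_right (0 : α) 1 1
  rwa [inf_one, zero_sup, one_inf, eq_comm] at h

theorem zero_inf_zero : (0 : α) ⊓ 0 = 0 := @one_sup_one α (dual α)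

theorem inf_self (x : α) : x ⊓ x = x := by
  have h := sup_inf_right (0 : α) 0 x
  rwa [zero_inf_zero, zero_sup, eq_comm] at h

theorem sup_self (x : α) : x ⊔ x = x := @inf_self α (dual α) x

/-- `x ◁ y` agrees with `x ⊓ (x ⊔ y)`. In a Płonka sum of lattices it is the image of `x` in the
fibre of the join of the indices of `x` and `y`. -/
def shift (x y : α) : α := x ⊔ 0 ⊓ y

infixl:67 " ◁ " => shift

theorem shift_eq_inf_sup (x y : α) : x ◁ y = x ⊓ (x ⊔ y) := by
  rw [shift, sup_inf, sup_zero]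

theorem shift_eq_sup_inf (x y : α) : x ◁ y = x ⊔ x ⊓ y := by
  rw [shift_eq_inf_sup, inf_sup, inf_self]

theorem shift_eq_inf_one_sup (x y : α) : x ◁ y = x ⊓ (1 ⊔ y) := by
  rw [shift_eq_sup_inf, inf_sup, inf_one]

theorem shift_self (x : α) : x ◁ x = x := by rw [shift_eq_inf_sup, sup_self, inf_self]

theorem inf_shift_left (x y : α) : (x ⊓ y) ◁ x = x ⊓ y := by
  rw [shift, inf_comm 0 x, ← inf_sup, sup_zero]

theorem inf_shift_right (x y : α) : (x ⊓ y) ◁ y = x ⊓ y := by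
  rw [inf_comm, inf_shift_left]

theorem one_shift (x : α) : 1 ◁ x = 1 ⊔ x := by rw [shift_eq_inf_one_sup, one_inf]

theorem shift_zero_inf (x y : α) : x ◁ (0 ⊓ y) = x ◁ y := by
  rw [shift_eq_inf_one_sup, shift_eq_inf_one_sup, ← one_shift y, shift]

theorem zero_inf_zero_inf (x : α) : (0 : α) ⊓ (0 ⊓ x) = 0 ⊓ x := by
  simpa only [shift, zero_sup] using shift_zero_inf (0 : α) x

theorem inf_zero_inf (x y : α) : x ⊓ (0 ⊓ y) = 0 ⊓ x ⊔ 0 ⊓ y := by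
  have h : 0 ⊓ y ⊔ x ⊓ (0 ⊓ y) = x ⊓ (0 ⊓ y) := by
    have := inf_shift_right x (0 ⊓ y)
    rwa [shift_zero_inf, shift, sup_comm] at this
  rw [← h, inf_comm x, ← shift_eq_sup_inf, shift, sup_comm]

theorem inf_shift_distrib (x y z : α) : (x ⊓ y) ◁ z = (x ◁ z) ⊓ (y ◁ z) := sup_inf_right _ _ _

theorem shift_shift_self (y z : α) : y ◁ z ◁ z = y ◁ z := by
  -- `◁` is its own dual, and `y ◁ z` is the join of `y` and `0 ⊓ z`
  have h := @inf_shift_right α (dual α) y (0 ⊓ z)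
  have e : ∀ a b : α, @shift α (dual α) a b = a ◁ b := fun a b =>
    (shift_eq_inf_one_sup a b).symm
  rw [e] at h
  exact (shift_zero_inf _ _).symm.trans h

theorem inf_shift_assoc (x y z : α) : x ⊓ (y ◁ z) = (x ⊓ y) ◁ z := by
  rw [inf_shift_distrib]
  have hw := shift_shift_self y z
  generalize y ◁ z = w at hw
  have h0 : 0 ⊓ z ⊓ w = 0 ⊓ w := by
    rw [inf_comm, inf_zero_inf]
    conv_rhs => rw [← hw, shift, inf_sup, zero_inf_zero_inf]
  conv_rhs => rw [shift, inf_sup_right, h0]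
  exact (inf_shift_right x w).symm

theorem shift_inf_assoc (x y z : α) : (x ◁ z) ⊓ y = (x ⊓ y) ◁ z := by
  rw [inf_comm, inf_shift_assoc, inf_comm]

theorem inf_inf_sup_inf_inf (x y z : α) : x ⊓ y ⊓ z ⊔ x ⊓ (y ⊓ z) = x ⊓ y ⊓ z := by
  calc x ⊓ y ⊓ z ⊔ x ⊓ (y ⊓ z) = x ⊓ (y ◁ z) ⊓ ((z ⊔ x) ⊓ (z ◁ y)) := by
        rw [sup_inf_right, ← inf_sup, ← shift_eq_sup_inf, sup_inf z x, shift_eq_sup_inf z y,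
          inf_comm z y]
    _ = ((x ⊓ y) ◁ z) ⊓ (z ◁ x ◁ y) := by
        rw [inf_shift_assoc, inf_shift_assoc, inf_comm (z ⊔ x) z, ← shift_eq_inf_sup]
    _ = (x ⊓ y ⊓ z) ◁ z ◁ x ◁ y := by
        rw [inf_shift_assoc, inf_shift_assoc, shift_inf_assoc]
    _ = x ⊓ y ⊓ z := by
        rw [inf_shift_right, ← shift_inf_assoc, inf_shift_left, ← shift_inf_assoc,
          inf_shift_right]

theorem inf_assoc (x y z : α) : x ⊓ y ⊓ z = x ⊓ (y ⊓ z) := by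
  -- both sides agree with their join
  have h := inf_inf_sup_inf_inf z y x
  rw [inf_comm z y, inf_comm (y ⊓ z), inf_comm z, inf_comm y x, sup_comm] at h
  exact (inf_inf_sup_inf_inf x y z).symm.trans h

theorem sup_assoc (x y z : α) : x ⊔ y ⊔ z = x ⊔ (y ⊔ z) := @inf_assoc α (dual α) x y z

theorem shift_inf (x y z : α) : x ◁ (y ⊓ z) = x ◁ y ◁ z := by
  simp only [shift_eq_inf_one_sup, sup_inf, inf_assoc]

theorem sup_shift_distrib (x y z : α) : (x ⊔ y) ◁ z = (x ◁ z) ⊔ (y ◁ z) := by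
  simp only [shift_eq_inf_one_sup, inf_sup_right]

theorem shift_shift (x y z : α) : x ◁ (y ◁ z) = x ◁ y ◁ z := by
  rw [shift, shift, shift, shift, inf_sup, zero_inf_zero_inf, sup_assoc]

theorem shift_zero (x : α) : x ◁ 0 = x := by rw [shift, zero_inf_zero, sup_zero]

theorem shift_one (x : α) : x ◁ 1 = x := by rw [shift, inf_one, sup_zero]

theorem sup_shift_assoc (x y z : α) : x ⊔ (y ◁ z) = (x ⊔ y) ◁ z := (sup_assoc _ _ _).symm

theorem shift_comm (x y z : α) : x ◁ y ◁ z = x ◁ z ◁ y := by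
  rw [← shift_inf, inf_comm, shift_inf]

theorem shift_sup (x y z : α) : x ◁ (y ⊔ z) = x ◁ y ◁ z := by
  simp only [shift, inf_sup, sup_assoc]

instance : Std.Associative (α := α) (· ⊓ ·) := ⟨inf_assoc⟩

instance : Std.Commutative (α := α) (· ⊓ ·) := ⟨inf_comm⟩

instance : Std.Associative (α := α) (· ⊔ ·) := ⟨sup_assoc⟩

instance : Std.Commutative (α := α) (· ⊔ ·) := ⟨sup_comm⟩

theorem inf_sup_inf_eq {a b c d : α} (hab : a ⊔ b = b) (hcd : c ⊔ d = d) :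
    a ⊓ c ⊔ b ⊓ d = b ⊓ d := by
  have e : b ⊓ d = a ⊓ c ⊔ (a ⊓ d ⊔ b ⊓ d) := by
    rw [← sup_assoc, ← inf_sup, hcd, ← inf_sup_right, hab]
  rw [e, ← sup_assoc, sup_self]

theorem sup_inf_sup_eq {a b c d : α} (hab : a ⊓ b = a) (hcd : c ⊓ d = c) :
    (a ⊔ c) ⊓ (b ⊔ d) = a ⊔ c := by
  rw [inf_comm] at hab hcd ⊢
  exact @inf_sup_inf_eq α (dual α) _ _ _ _ hab hcd

/-- The image of a truth value. -/
def ofBool (b : Bool) : α := if b then 1 else 0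

end

instance : DistribBisemilattice Bool where
  min := and
  max := or
  zero := false
  one := true
  inf_comm := Bool.and_comm
  sup_comm := Bool.or_comm
  inf_one := Bool.and_true
  sup_zero := Bool.or_false
  inf_sup := Bool.and_or_distrib_left
  sup_inf := Bool.or_and_distrib_left

section

variable {α : Type*} [DistribBisemilattice α]

theorem ofBool_inf (b c : Bool) : (ofBool (b ⊓ c) : α) = ofBool b ⊓ ofBool c := by
  cases b <;> cases c
  · exact zero_inf_zero.symm
  · exact (inf_one _).symm
  · exact (one_inf _).symm
  · exact (inf_one _).symm

theorem ofBool_sup (b c : Bool) : (ofBool (b ⊔ c) : α) = ofBool b ⊔ ofBool c := by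
  cases b <;> cases c
  · exact (sup_zero _).symm
  · exact (zero_sup _).symm
  · exact (sup_zero _).symm
  · exact one_sup_one.symm

end

/-! ### Terms in two operations and their expansion -/

/-- Terms in the operations `⊓` and `⊔` over the variables `κ`. -/
inductive LatTerm (κ : Type*) where
  | var (k : κ)
  | inf (s t : LatTerm κ)
  | sup (s t : LatTerm κ)

namespace LatTerm

variable {κ : Type*} {α : Type*} [DistribBisemilattice α]

/-- The value of a term in a distributive bisemilattice. -/
def eval {α : Type*} [DistribBisemilattice α] (v : κ → α) : LatTerm κ → α
  | var k => v k
  | inf s t => s.eval v ⊓ t.eval v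
  | sup s t => s.eval v ⊔ t.eval v

/-- The variables of a term, from left to right. -/
def vars : LatTerm κ → List κ
  | var k => [k]
  | inf s t => s.vars ++ t.vars
  | sup s t => s.vars ++ t.vars

theorem eval_congr {v w : κ → α} (t : LatTerm κ) (h : ∀ k ∈ t.vars, v k = w k) :
    t.eval v = t.eval w := by
  induction t with
  | var k => exact h k (List.mem_singleton_self k)
  | inf s t hs ht =>
    simp only [vars, List.mem_append] at h
    simp only [eval, hs fun k hk => h k (Or.inl hk), ht fun k hk => h k (Or.inr hk)]
  | sup s t hs ht =>
    simp only [vars, List.mem_append] at h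
    simp only [eval, hs fun k hk => h k (Or.inl hk), ht fun k hk => h k (Or.inr hk)]

theorem eval_ofBool (β : κ → Bool) (t : LatTerm κ) :
    t.eval (fun k => (ofBool (β k) : α)) = ofBool (t.eval β) := by
  induction t with
  | var k => rfl
  | inf s t hs ht => simp only [eval, hs, ht, ofBool_inf]
  | sup s t hs ht => simp only [eval, hs, ht, ofBool_sup]

theorem eval_shift_of_mem (v : κ → α) {k : κ} (t : LatTerm κ) (h : k ∈ t.vars) :
    t.eval v ◁ v k = t.eval v := by
  induction t with
  | var j =>
    obtain rfl := List.mem_singleton.1 h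
    exact shift_self _
  | inf s t hs ht =>
    rcases List.mem_append.1 h with h | h
    · rw [eval, ← shift_inf_assoc, hs h]
    · rw [eval, ← inf_shift_assoc, ht h]
  | sup s t hs ht =>
    rcases List.mem_append.1 h with h | h
    · rw [eval, sup_comm, ← sup_shift_assoc, hs h]
    · rw [eval, ← sup_shift_assoc, ht h]

theorem shift_eval_of_forall (v : κ → α) {z : α} (t : LatTerm κ)
    (h : ∀ k ∈ t.vars, z ◁ v k = z) : z ◁ t.eval v = z := by
  induction t with
  | var k => exact h k (List.mem_singleton_self k)
  | inf s t hs ht =>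
    simp only [vars, List.mem_append] at h
    rw [eval, shift_inf, hs fun k hk => h k (Or.inl hk), ht fun k hk => h k (Or.inr hk)]
  | sup s t hs ht =>
    simp only [vars, List.mem_append] at h
    rw [eval, shift_sup, hs fun k hk => h k (Or.inl hk), ht fun k hk => h k (Or.inr hk)]

section Shannon

variable [DecidableEq κ] (v : κ → α) (k l : κ)

/-- Terms are monotone in each variable, and the substitution of `0` or `1` leads to the same
fibre. -/
theorem eval_update_zero_sup_one (t : LatTerm κ) :
    t.eval (Function.update v k 0) ⊔ t.eval (Function.update v k 1) =
      t.eval (Function.update v k 1) := by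
  induction t with
  | var j =>
    by_cases h : j = k
    · subst h
      simp only [eval, Function.update_self, zero_sup]
    · simp only [eval, Function.update_of_ne h, sup_self]
  | inf s t hs ht => exact inf_sup_inf_eq hs ht
  | sup s t hs ht =>
    conv_rhs => rw [eval, ← hs, ← ht]
    simp only [eval]
    ac_rfl

theorem eval_update_zero_inf_one (t : LatTerm κ) :
    t.eval (Function.update v k 0) ⊓ t.eval (Function.update v k 1) =
      t.eval (Function.update v k 0) := by
  induction t with
  | var j =>
    by_cases h : j = k
    · subst h
      simp only [eval, Function.update_self, inf_one]
    · simp only [eval, Function.update_of_ne h, inf_self]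
  | inf s t hs ht =>
    conv_rhs => rw [eval, ← hs, ← ht]
    simp only [eval]
    ac_rfl
  | sup s t hs ht => exact sup_inf_sup_eq hs ht

/-- Shannon expansion. In the absence of absorption the left side has to be shifted to a fibre
in which `v k` is accounted for. -/
theorem eval_shift_eq (t : LatTerm κ) :
    t.eval v ◁ v k =
      t.eval (Function.update v k 0) ⊔ v k ⊓ t.eval (Function.update v k 1) := by
  induction t with
  | var j =>
    by_cases h : j = k
    · subst h
      simp only [eval, Function.update_self, shift_self, inf_one, zero_sup]
    · simp only [eval, Function.update_of_ne h]
      rw [shift_eq_sup_inf, inf_comm]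
  | inf s t hs ht =>
    have hs' := eval_update_zero_sup_one v k s
    have ht' := eval_update_zero_sup_one v k t
    simp only [eval, inf_shift_distrib, hs, ht]
    generalize s.eval (Function.update v k 0) = a, s.eval (Function.update v k 1) = b,
      t.eval (Function.update v k 0) = c, t.eval (Function.update v k 1) = d, v k = x at *
    have h₁ : x ⊓ (a ⊓ d) ⊔ x ⊓ (b ⊓ d) = x ⊓ (b ⊓ d) := by
      rw [← inf_sup, inf_sup_inf_eq hs' (sup_self d)]
    have h₂ : x ⊓ (b ⊓ c) ⊔ x ⊓ (b ⊓ d) = x ⊓ (b ⊓ d) := by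
      rw [← inf_sup, inf_sup_inf_eq (sup_self b) ht']
    calc (a ⊔ x ⊓ b) ⊓ (c ⊔ x ⊓ d)
        = a ⊓ c ⊔ (x ⊓ (b ⊓ c) ⊔ (x ⊓ (a ⊓ d) ⊔ (x ⊓ x) ⊓ (b ⊓ d))) := by
          simp only [inf_sup, inf_sup_right]
          ac_rfl
      _ = a ⊓ c ⊔ x ⊓ (b ⊓ d) := by rw [inf_self, h₁, h₂]
  | sup s t hs ht =>
    simp only [eval, sup_shift_distrib, hs, ht, inf_sup]
    ac_rfl

/-- Expansion in two variables whose values are complementary in their common fibre: only the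
two assignments of complementary truth values are needed. -/
theorem eval_shift_shift_eq (hkl : k ≠ l) (hs : v k ⊔ v l = 1 ⊔ (v k ⊔ v l))
    (hi : v k ⊓ v l = 0 ⊓ (v k ⊓ v l)) (t : LatTerm κ) :
    t.eval v ◁ v k ◁ v l =
      v k ⊓ t.eval (Function.update (Function.update v k 1) l 0) ⊔
        v l ⊓ t.eval (Function.update (Function.update v k 0) l 1) := by
  have hl : ∀ c, Function.update v k c l = v l := fun c => Function.update_of_ne hkl.symm _ _
  have e₀ := eval_shift_eq (Function.update v k 0) l t
  have e₁ := eval_shift_eq (Function.update v k 1) l t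
  rw [hl] at e₀ e₁
  rw [eval_shift_eq, sup_shift_distrib, ← inf_shift_assoc, e₀, e₁]
  have m₁ := eval_update_zero_inf_one (Function.update v k 1) l t
  have m₂ := eval_update_zero_sup_one (Function.update v k 0) l t
  have m₃ := eval_update_zero_sup_one (Function.update v l 0) k t
  simp only [Function.update_comm hkl.symm] at m₃
  generalize t.eval (Function.update (Function.update v k 0) l 0) = a,
    t.eval (Function.update (Function.update v k 1) l 0) = b,
    t.eval (Function.update (Function.update v k 0) l 1) = c,
    t.eval (Function.update (Function.update v k 1) l 1) = d, v k = x, v l = y at *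
  have h₁ : x ⊓ b ⊔ x ⊓ (y ⊓ d) = (x ⊓ b) ◁ y := by
    rw [← inf_assoc, hi, inf_assoc, ← shift, shift_inf, shift_inf, inf_shift_left, shift_comm,
      ← inf_shift_assoc x b d, shift_eq_sup_inf b d, m₁, sup_self]
  have h₂ : a ⊔ (x ⊓ a ⊔ y ⊓ a) = x ⊓ a ⊔ y ⊓ a := by
    rw [← inf_sup_right, inf_comm, ← shift_eq_sup_inf, shift_eq_inf_one_sup, ← hs]
  calc a ⊔ y ⊓ c ⊔ x ⊓ (b ⊔ y ⊓ d)
      = a ⊔ (x ⊓ b ⊔ ((y ⊓ c) ◁ y)) := by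
        rw [inf_sup, h₁]
        simp only [shift]
        ac_rfl
    _ = a ⊔ (x ⊓ (a ⊔ b) ⊔ y ⊓ (a ⊔ c)) := by rw [inf_shift_left, m₂, m₃]
    _ = (a ⊔ (x ⊓ a ⊔ y ⊓ a)) ⊔ (x ⊓ b ⊔ y ⊓ c) := by
        rw [inf_sup, inf_sup]
        ac_rfl
    _ = x ⊓ (a ⊔ b) ⊔ y ⊓ (a ⊔ c) := by
        rw [h₂, inf_sup, inf_sup]
        ac_rfl
    _ = x ⊓ b ⊔ y ⊓ c := by rw [m₂, m₃]

end Shannon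

/-! ### Comparing terms in literals -/

/-- A literal: `(i, true)` stands for the variable `i` and `(i, false)` for its negation. -/
abbrev Literal : Type := ℕ × Bool

/-- The valuation `w` with new values `x`, `y` for the two literals of the variable `i`. -/
def assign {γ : Type*} (w : Literal → γ) (i : ℕ) (x y : γ) : Literal → γ :=
  fun k => if k.1 = i then (if k.2 then x else y) else w k

section

variable {α : Type*} [DistribBisemilattice α]

theorem update_update_eq_assign {γ : Type*} (w : Literal → γ) (i : ℕ) (x y : γ) :
    Function.update (Function.update w (i, true) x) (i, false) y = assign w i x y := by
  funext ⟨j, p⟩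
  by_cases h : j = i <;> cases p <;> simp [assign, h]

/-- The assignments of truth values to a variable and its negation that lie in the
two-element Boolean algebra. -/
def classical : List (Bool × Bool) := [(true, false), (false, true)]

/-- All assignments of truth values to a variable and its negation, when these are treated as
independent. -/
def allPairs : List (Bool × Bool) := [(true, false), (false, true), (false, false), (true, true)]

/-- If the literals of the variable `i` have the values `a` and `b`, then `s` and `t` can be
compared, after a shift by `g`, by giving these literals the truth values from `X` only. -/
def Resolves (X : List (Bool × Bool)) (s t : LatTerm Literal) (i : ℕ) (a b g : α) : Prop :=
  ∀ (w : Literal → α) (f : α), w (i, true) = a → w (i, false) = b →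
    (∀ p ∈ X, s.eval (assign w i (ofBool p.1) (ofBool p.2)) ◁ f =
      t.eval (assign w i (ofBool p.1) (ofBool p.2)) ◁ f) →
    s.eval w ◁ g ◁ f = t.eval w ◁ g ◁ f

theorem resolves_allPairs (s t : LatTerm Literal) (i : ℕ) (a b : α) :
    Resolves allPairs s t i a b (a ⊓ b) := by
  rintro w f rfl rfl h
  have hne : ((i, false) : Literal) ≠ (i, true) := by simp
  have key : ∀ r : LatTerm Literal, r.eval w ◁ (w (i, true) ⊓ w (i, false)) ◁ f =
      ((r.eval (assign w i 0 0) ◁ f) ⊔ w (i, false) ⊓ (r.eval (assign w i 0 1) ◁ f)) ⊔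
        w (i, true) ⊓ ((r.eval (assign w i 1 0) ◁ f) ⊔
          w (i, false) ⊓ (r.eval (assign w i 1 1) ◁ f)) := by
    intro r
    have e := fun c => eval_shift_eq (Function.update w (i, true) c) (i, false) r
    simp only [Function.update_of_ne hne, update_update_eq_assign] at e
    rw [shift_inf, eval_shift_eq, sup_shift_distrib, ← inf_shift_assoc, e, e]
    simp only [sup_shift_distrib, ← inf_shift_assoc]
  rw [key, key]
  simp only [allPairs, List.forall_mem_cons, ofBool] at h
  obtain ⟨h₁, h₂, h₃, h₄, -⟩ := h
  simp only [if_true, Bool.false_eq_true, if_false] at h₁ h₂ h₃ h₄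
  rw [h₁, h₂, h₃, h₄]

theorem resolves_classical (s t : LatTerm Literal) (i : ℕ) {a b : α}
    (hs : a ⊔ b = 1 ⊔ (a ⊔ b)) (hi : a ⊓ b = 0 ⊓ (a ⊓ b)) :
    Resolves classical s t i a b (a ⊓ b) := by
  rintro w f rfl rfl h
  have hne : ((i, true) : Literal) ≠ (i, false) := by simp
  have key : ∀ r : LatTerm Literal, r.eval w ◁ (w (i, true) ⊓ w (i, false)) ◁ f =
      w (i, true) ⊓ (r.eval (assign w i 1 0) ◁ f) ⊔
        w (i, false) ⊓ (r.eval (assign w i 0 1) ◁ f) := by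
    intro r
    rw [shift_inf, eval_shift_shift_eq _ _ _ hne hs hi, update_update_eq_assign,
      update_update_eq_assign]
    simp only [sup_shift_distrib, ← inf_shift_assoc]
  rw [key, key]
  simp only [classical, List.forall_mem_cons, ofBool] at h
  obtain ⟨h₁, h₂, -⟩ := h
  simp only [if_true, Bool.false_eq_true, if_false] at h₁ h₂
  rw [h₁, h₂]

/-- If only one literal of a variable occurs, the value of the other one is irrelevant, so the
classical assignments are all that a Shannon expansion needs. -/
theorem resolves_of_not_mem {s t : LatTerm Literal} {i : ℕ} (p : Bool)
    (hs : (i, !p) ∉ s.vars) (ht : (i, !p) ∉ t.vars) (a b : α) :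
    Resolves classical s t i a b (if p then a else b) := by
  rintro w f rfl rfl h
  have key : ∀ r : LatTerm Literal, (i, !p) ∉ r.vars →
      r.eval w ◁ (if p then w (i, true) else w (i, false)) ◁ f =
      (r.eval (assign w i (ofBool (!p)) (ofBool p)) ◁ f) ⊔
        w (i, p) ⊓ (r.eval (assign w i (ofBool p) (ofBool (!p))) ◁ f) := by
    intro r hr
    have e : ∀ c x y : α, (if p then x else y) = c →
        r.eval (Function.update w (i, p) c) = r.eval (assign w i x y) := by
      intro c x y hc
      refine eval_congr r fun k hk => ?_
      have hk' : k ≠ (i, !p) := fun h => hr (h ▸ hk)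
      obtain ⟨j, q⟩ := k
      by_cases hj : j = i
      · subst hj
        have hq : q = p := by
          cases p <;> cases q <;> simp_all
        subst hq
        simpa [assign] using hc.symm
      · simp [assign, hj]
    have hp : (if p then w (i, true) else w (i, false)) = w (i, p) := by cases p <;> rfl
    rw [hp, eval_shift_eq, e 0 (ofBool (!p)) (ofBool p), e 1 (ofBool p) (ofBool (!p))]
    · simp only [sup_shift_distrib, ← inf_shift_assoc]
    · cases p <;> simp [ofBool]
    · cases p <;> simp [ofBool]
  rw [key s hs, key t ht]
  simp only [classical, List.forall_mem_cons] at h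
  obtain ⟨h₁, h₂, -⟩ := h
  cases p
  · simp only [Bool.not_false]
    rw [h₁, h₂]
  · simp only [Bool.not_true]
    rw [h₁, h₂]

/-- If the variables can be resolved, it suffices to compare two terms at truth values. -/
theorem shift_eval_eq_shift_eval {X : List (Bool × Bool)} {s t : LatTerm Literal} {L₀ : List ℕ}
    (hs : ∀ k ∈ s.vars, k.1 ∈ L₀) (ht : ∀ k ∈ t.vars, k.1 ∈ L₀)
    (hX : ∀ β : Literal → Bool, (∀ i ∈ L₀, (β (i, true), β (i, false)) ∈ X) →
      (ofBool (s.eval β) : α) = ofBool (t.eval β))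
    (v : Literal → α) (g : ℕ → α)
    (hg : ∀ i ∈ L₀, Resolves X s t i (v (i, true)) (v (i, false)) (g i))
    (L : List ℕ) (hL : L.Nodup) (hsub : L ⊆ L₀) (w : Literal → α) (β : Literal → Bool)
    (hv : ∀ i ∈ L, ∀ p, w (i, p) = v (i, p))
    (hw : ∀ i ∈ L₀, i ∉ L → (∀ p, w (i, p) = ofBool (β (i, p))) ∧
      (β (i, true), β (i, false)) ∈ X) :
    s.eval w ◁ L.foldr (fun i f => g i ⊓ f) 1 = t.eval w ◁ L.foldr (fun i f => g i ⊓ f) 1 := by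
  induction L generalizing w β with
  | nil =>
    have e : ∀ r : LatTerm Literal, (∀ k ∈ r.vars, k.1 ∈ L₀) →
        r.eval w = ofBool (r.eval β) := fun r hr => by
      rw [← eval_ofBool]
      exact eval_congr r fun k hk => (hw k.1 (hr k hk) List.not_mem_nil).1 k.2
    rw [e s hs, e t ht, hX β fun i hi => (hw i hi List.not_mem_nil).2]
  | cons i L ih =>
    rw [List.foldr_cons, shift_inf, shift_inf]
    rw [List.nodup_cons] at hL
    refine hg i (hsub List.mem_cons_self) w _ (hv i List.mem_cons_self true)
      (hv i List.mem_cons_self false) fun p hp => ?_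
    refine ih hL.2 (fun j hj => hsub (List.mem_cons_of_mem _ hj)) _
      (assign β i p.1 p.2) ?_ ?_
    · intro j hj q
      have hji : j ≠ i := fun h => hL.1 (h ▸ hj)
      simpa [assign, hji] using hv j (List.mem_cons_of_mem _ hj) q
    · intro j hj hjL
      by_cases hji : j = i
      · subst hji
        refine ⟨fun q => ?_, by simpa [assign] using hp⟩
        cases q <;> simp [assign]
      · have := hw j hj (by simp [hji, hjL])
        simpa [assign, hji] using this

/-- The comparison of two terms that do not change under the shifts needed. -/
theorem eval_eq_eval {X : List (Bool × Bool)} {s t : LatTerm Literal} {L : List ℕ}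
    (hL : L.Nodup) (hs : ∀ k ∈ s.vars, k.1 ∈ L) (ht : ∀ k ∈ t.vars, k.1 ∈ L)
    (hX : ∀ β : Literal → Bool, (∀ i ∈ L, (β (i, true), β (i, false)) ∈ X) →
      (ofBool (s.eval β) : α) = ofBool (t.eval β))
    (v : Literal → α) (h : ∀ i ∈ L, ∃ g, Resolves X s t i (v (i, true)) (v (i, false)) g ∧
      s.eval v ◁ g = s.eval v ∧ t.eval v ◁ g = t.eval v) :
    s.eval v = t.eval v := by
  choose! g hg hgs hgt using h
  have e := shift_eval_eq_shift_eval hs ht hX v g hg L hL (List.Subset.refl L) v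
    (fun _ => true) (fun _ _ _ => rfl) fun i hi hi' => absurd hi hi'
  have fold : ∀ (x : α) (M : List ℕ), (∀ i ∈ M, x ◁ g i = x) →
      x ◁ M.foldr (fun i f => g i ⊓ f) 1 = x := by
    intro x M hM
    induction M with
    | nil => exact shift_one x
    | cons i M ih =>
      rw [List.foldr_cons, shift_inf, hM i List.mem_cons_self,
        ih fun j hj => hM j (List.mem_cons_of_mem _ hj)]
  rwa [fold _ L hgs, fold _ L hgt] at e

end

end LatTerm

end DistribBisemilattice

/-! ### Bisemilattices with a De Morgan involution -/

/-- A bounded distributive bisemilattice with an involution that satisfies the De Morgan laws. -/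
class DeMorganBisemilattice (α : Type*) extends DistribBisemilattice α, Compl α where
  compl_compl (x : α) : xᶜᶜ = x
  compl_sup (x y : α) : (x ⊔ y)ᶜ = xᶜ ⊓ yᶜ
  compl_zero : (0 : α)ᶜ = 1

namespace DeMorganBisemilattice

open DistribBisemilattice LatTerm

section

variable {α : Type*} [DeMorganBisemilattice α]

theorem compl_one : (1 : α)ᶜ = 0 := by rw [← compl_zero, compl_compl]

/-- The value of a groupoid term, where `x → y` is `xᶜ ⊔ y`. -/
def impEval {α : Type*} [DeMorganBisemilattice α] (v : ℕ → α) : FreeMagma ℕ → α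
  | .of i => v i
  | .mul s t => (impEval v s)ᶜ ⊔ impEval v t

end

/-- The term in literals for a groupoid term (`true`) or for its negation (`false`), with the
negations pushed to the variables. -/
def toLat : Bool → FreeMagma ℕ → LatTerm Literal
  | p, .of i => .var (i, p)
  | true, .mul s t => .sup (toLat false s) (toLat true t)
  | false, .mul s t => .inf (toLat true s) (toLat false t)

theorem fst_mem_letters {p : Bool} {t : FreeMagma ℕ} {k : Literal} (h : k ∈ (toLat p t).vars) :
    k.1 ∈ letters t := by
  induction t using FreeMagma.rec generalizing p with
  | of i => cases List.mem_singleton.1 h; exact List.mem_singleton_self _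
  | mul s t hs ht =>
    rw [letters, List.mem_append]
    cases p <;> exact (List.mem_append.1 h).imp hs ht

theorem exists_literal_mem {p : Bool} {t : FreeMagma ℕ} {i : ℕ} (h : i ∈ letters t) :
    ∃ q, (i, q) ∈ (toLat p t).vars := by
  induction t using FreeMagma.rec generalizing p with
  | of j => cases List.mem_singleton.1 h; exact ⟨p, List.mem_singleton_self _⟩
  | mul s t hs ht =>
    rw [letters, List.mem_append] at h
    cases p <;> exact h.elim (fun h => (hs h).imp fun q => List.mem_append_left _)
      (fun h => (ht h).imp fun q => List.mem_append_right _)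

section

variable {α : Type*} [DeMorganBisemilattice α]

/-- The values of the literals for given values of the variables. -/
def litVal (v : ℕ → α) : Literal → α := fun k => if k.2 then v k.1 else (v k.1)ᶜ

theorem eval_toLat (v : ℕ → α) (p : Bool) (t : FreeMagma ℕ) :
    (toLat p t).eval (litVal v) = if p then impEval v t else (impEval v t)ᶜ := by
  induction t using FreeMagma.rec generalizing p with
  | of i => rfl
  | mul s t hs ht =>
    cases p <;> simp [toLat, eval, impEval, hs, ht, compl_sup, compl_compl]

theorem eval_toLat_eq_eval_toLat {s t : FreeMagma ℕ} (h : ∀ v : ℕ → α, impEval v s = impEval v t)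
    (v : ℕ → α) : (toLat true s).eval (litVal v) = (toLat true t).eval (litVal v) := by
  simp [eval_toLat, h v]

end

/-! ### Three conditions -/

section

variable (α : Type*) [DeMorganBisemilattice α]

/-- The involution maps every Płonka fibre to itself. -/
def ComplFibrewise : Prop := ∀ x : α, x ◁ xᶜ = x

/-- In the common fibre of `x` and `xᶜ`, the join `x ⊔ xᶜ` is the top element. -/
def IsComplemented : Prop := ∀ x : α, x ⊔ xᶜ = 1 ⊔ (x ⊔ xᶜ)

variable {α}

theorem IsComplemented.inf_compl (h : IsComplemented α) (x : α) : x ⊓ xᶜ = 0 ⊓ (x ⊓ xᶜ) := by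
  have := congrArg compl (h xᶜ)
  simpa only [compl_sup, compl_compl, compl_one, DistribBisemilattice.inf_comm xᶜ] using this

theorem isComplemented_of_zero_eq_one (h : (0 : α) = 1) : IsComplemented α := fun x => by
  rw [← h, zero_sup]

theorem complFibrewise_of_literal {s t : FreeMagma ℕ}
    (h : ∀ v : ℕ → α, impEval v s = impEval v t) {k : Literal} (ht : k ∈ (toLat true t).vars)
    (hs : k ∉ (toLat true s).vars) : ComplFibrewise α := by
  intro z
  obtain ⟨i, p⟩ := k
  -- the literal `(i, p)` gets the value `zᶜ`, the opposite one `z`, the others `0` or `1`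
  let v : ℕ → α := fun j => if j = i then (if p then zᶜ else z) else 0
  have e := eval_toLat_eq_eval_toLat h v
  have h₁ : (toLat true t).eval (litVal v) ◁ zᶜ = (toLat true t).eval (litVal v) := by
    have := eval_shift_of_mem (litVal v) _ ht
    have hz : litVal v (i, p) = zᶜ := by cases p <;> simp [litVal, v]
    rwa [hz] at this
  have h₂ : z ◁ (toLat true s).eval (litVal v) = z := by
    refine shift_eval_of_forall _ _ fun k hk => ?_
    obtain ⟨j, q⟩ := k
    by_cases hj : j = i
    · subst hj
      have hq : q ≠ p := fun h => hs (h ▸ hk)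
      have : litVal v (j, q) = z := by
        cases p <;> cases q <;> simp_all [litVal, v, compl_compl]
      rw [this, shift_self]
    · cases q <;> simp [litVal, v, hj, compl_zero, shift_one, shift_zero]
  rw [e] at h₂
  calc z ◁ zᶜ = z ◁ (toLat true t).eval (litVal v) ◁ zᶜ := by rw [h₂]
    _ = z := by rw [← shift_shift, h₁, h₂]

theorem zero_eq_one_of_eval_ne {s t : FreeMagma ℕ}
    (h : ∀ v : ℕ → α, impEval v s = impEval v t) {β : Literal → Bool}
    (hβ : ∀ i, (β (i, true), β (i, false)) ∈ classical)
    (hne : (toLat true s).eval β ≠ (toLat true t).eval β) : (0 : α) = 1 := by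
  have e := eval_toLat_eq_eval_toLat h fun i => (ofBool (β (i, true)) : α)
  have hl : litVal (fun i => (ofBool (β (i, true)) : α)) = fun k => ofBool (β k) := by
    funext ⟨i, p⟩
    have := hβ i
    simp only [classical, List.mem_cons, Prod.mk.injEq, List.not_mem_nil, or_false] at this
    obtain ⟨h₁, h₂⟩ | ⟨h₁, h₂⟩ := this <;> cases p <;>
      simp [litVal, h₁, h₂, ofBool, compl_zero, compl_one]
  rw [hl, eval_ofBool, eval_ofBool] at e
  revert e hne
  generalize (toLat true s).eval β = b, (toLat true t).eval β = c
  cases b <;> cases c <;> simp [ofBool, eq_comm]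

/-- The assignments of truth values to a variable and its negation in which these are not both
true. -/
def threeValued : List (Bool × Bool) := [(true, false), (false, true), (false, false)]

theorem isComplemented_of_eval_ne {s t : FreeMagma ℕ}
    (h : ∀ v : ℕ → α, impEval v s = impEval v t) {β : Literal → Bool}
    (hβ : ∀ i, (β (i, true), β (i, false)) ∈ threeValued)
    (hne : (toLat true s).eval β ≠ (toLat true t).eval β) : IsComplemented α := by
  intro z
  -- a variable with two false literals gets the value `z`, and joining `z ⊔ zᶜ` to a term
  -- replaces its value by its truth value
  let v : ℕ → α := fun i =>
    if β (i, true) then 1 else if β (i, false) then 0 else z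
  have e := eval_toLat_eq_eval_toLat h v
  have key : ∀ r : LatTerm Literal,
      r.eval (litVal v) ⊔ (z ⊔ zᶜ) = ofBool (r.eval β) ⊔ (z ⊔ zᶜ) := by
    intro r
    induction r with
    | var k =>
      obtain ⟨i, p⟩ := k
      have := hβ i
      simp only [threeValued, List.mem_cons, Prod.mk.injEq, List.not_mem_nil, or_false] at this
      obtain ⟨h₁, h₂⟩ | ⟨h₁, h₂⟩ | ⟨h₁, h₂⟩ := this <;> cases p <;>
        simp [litVal, eval, v, h₁, h₂, ofBool, compl_zero, compl_one, zero_sup]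
      · rw [sup_comm z, ← DistribBisemilattice.sup_assoc, sup_self]
      · rw [← DistribBisemilattice.sup_assoc, sup_self]
    | inf s t hs ht =>
      rw [eval, eval, ofBool_inf, DistribBisemilattice.sup_inf_right, hs, ht,
        ← DistribBisemilattice.sup_inf_right]
    | sup s t hs ht =>
      have dup : ∀ a b c : α, a ⊔ b ⊔ c = (a ⊔ c) ⊔ (b ⊔ c) := fun a b c => by
        conv_lhs => rw [← sup_self c]
        ac_rfl
      rw [eval, eval, ofBool_sup, dup, hs, ht, ← dup]
  have e' := key (toLat true s)
  rw [e, key] at e'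
  revert e' hne
  generalize (toLat true s).eval β = b, (toLat true t).eval β = c
  cases b <;> cases c <;> simp [ofBool, zero_sup, eq_comm]

end

/-! ### Deciding which conditions a law amounts to -/

/-- The same literals occur in the two terms. -/
def sameLiterals (s t : FreeMagma ℕ) : Bool :=
  (toLat true s).vars.all (fun k => (toLat true t).vars.contains k) &&
    (toLat true t).vars.all (fun k => (toLat true s).vars.contains k)

/-- The lists of length `n` with entries from `X`. -/
def assignments (X : List (Bool × Bool)) : ℕ → List (List (Bool × Bool))
  | 0 => [[]]
  | n + 1 => X.flatMap fun p => (assignments X n).map (p :: ·)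

/-- The assignment of truth values to the literals that is given by a list of pairs. -/
def ofPairs (l : List (Bool × Bool)) : Literal → Bool := fun k =>
  if k.2 then (l.getD k.1 (true, false)).1 else (l.getD k.1 (true, false)).2

/-- The two terms have the same truth value whenever the literals of each of the variables
`0, …, 3` are assigned truth values from `X`. -/
def agree (X : List (Bool × Bool)) (s t : FreeMagma ℕ) : Bool :=
  (assignments X 4).all fun l =>
    (toLat true s).eval (ofPairs l) == (toLat true t).eval (ofPairs l)

theorem mem_assignments {X : List (Bool × Bool)} {n : ℕ} {l : List (Bool × Bool)} :
    l ∈ assignments X n ↔ l.length = n ∧ ∀ p ∈ l, p ∈ X := by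
  induction n generalizing l with
  | zero =>
    simp only [assignments, List.mem_singleton, List.length_eq_zero_iff]
    exact ⟨fun h => by simp [h], fun h => h.1⟩
  | succ n ih =>
    cases l with
    | nil => simp [assignments]
    | cons q l => simp [assignments, ih]; tauto

theorem eval_eq_of_agree {X : List (Bool × Bool)} {s t : FreeMagma ℕ} (h : agree X s t = true)
    (hs : ∀ i ∈ letters s, i < 4) (ht : ∀ i ∈ letters t, i < 4) {β : Literal → Bool}
    (hβ : ∀ i < 4, (β (i, true), β (i, false)) ∈ X) :
    (toLat true s).eval β = (toLat true t).eval β := by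
  let l := (List.range 4).map fun i => (β (i, true), β (i, false))
  have hl : l ∈ assignments X 4 := by
    rw [mem_assignments]
    refine ⟨by simp [l], fun p hp => ?_⟩
    obtain ⟨i, hi, rfl⟩ := List.mem_map.1 hp
    exact hβ i (List.mem_range.1 hi)
  have e := eq_of_beq (List.all_eq_true.1 h l hl)
  have hβl : ∀ k : Literal, k.1 < 4 → ofPairs l k = β k := by
    rintro ⟨i, p⟩ hi
    have hi' : i < 4 := hi
    cases p <;> simp [ofPairs, l, List.getD, hi']
  rwa [eval_congr _ fun k hk => hβl k (hs _ (fst_mem_letters hk)),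
    eval_congr (toLat true t) fun k hk => hβl k (ht _ (fst_mem_letters hk))] at e

theorem exists_eval_ne_of_agree_eq_false {X : List (Bool × Bool)} {s t : FreeMagma ℕ}
    (hX : (true, false) ∈ X) (h : agree X s t = false) :
    ∃ β : Literal → Bool, (∀ i, (β (i, true), β (i, false)) ∈ X) ∧
      (toLat true s).eval β ≠ (toLat true t).eval β := by
  rw [agree, List.all_eq_false] at h
  obtain ⟨l, hl, hne⟩ := h
  refine ⟨ofPairs l, fun i => ?_, fun e => hne (beq_iff_eq.2 e)⟩
  have : (ofPairs l (i, true), ofPairs l (i, false)) = l.getD i (true, false) := rfl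
  rw [this, List.getD_eq_getElem?_getD]
  by_cases hi : i < l.length
  · rw [List.getElem?_eq_getElem hi]
    exact (mem_assignments.1 hl).2 _ (List.getElem_mem hi)
  · rwa [List.getElem?_eq_none (not_lt.1 hi)]

/-- The profile of a law says whether its two sides have the same literals, the same classical
truth values, and the same three-valued truth values. -/
structure Profile where
  literals : Bool
  classical : Bool
  threeValued : Bool
  deriving DecidableEq

/-- The profile of the law `s ≈ t`. -/
def profile (s t : FreeMagma ℕ) : Profile :=
  ⟨sameLiterals s t, agree classical s t, agree threeValued s t⟩

/-- The conditions on a bisemilattice that correspond to a profile. -/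
def Profile.Holds (P : Profile) (α : Type*) [DeMorganBisemilattice α] : Prop :=
  (P.literals = false → ComplFibrewise α) ∧ (P.classical = false → (0 : α) = 1) ∧
    (P.threeValued = false → IsComplemented α)

section

variable {α : Type*} [DeMorganBisemilattice α]

theorem holds_profile {s t : FreeMagma ℕ} (h : ∀ v : ℕ → α, impEval v s = impEval v t) :
    (profile s t).Holds α := by
  refine ⟨fun hp => ?_, fun hp => ?_, fun hp => ?_⟩
  · rw [profile, sameLiterals, Bool.and_eq_false_iff, List.all_eq_false, List.all_eq_false] at hp
    obtain ⟨k, h₁, h₂⟩ | ⟨k, h₁, h₂⟩ := hp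
    · exact complFibrewise_of_literal (fun v => (h v).symm) h₁ (by simpa using h₂)
    · exact complFibrewise_of_literal h h₁ (by simpa using h₂)
  · obtain ⟨β, hβ, hne⟩ := exists_eval_ne_of_agree_eq_false (by simp [classical]) hp
    exact zero_eq_one_of_eval_ne h hβ hne
  · obtain ⟨β, hβ, hne⟩ := exists_eval_ne_of_agree_eq_false (by simp [threeValued]) hp
    exact isComplemented_of_eval_ne h hβ hne

theorem impEval_eq_of_resolves {X : List (Bool × Bool)} {s t : FreeMagma ℕ}
    (hst : letters s = letters t) (hX : ∀ p ∈ classical, p ∈ X)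
    (hres : ∀ (i : ℕ) (a : α), Resolves X (toLat true s) (toLat true t) i a aᶜ (a ⊓ aᶜ))
    (hlit : sameLiterals s t = false → ComplFibrewise α)
    (hag : ∀ β : Literal → Bool, (∀ i ∈ letters s, (β (i, true), β (i, false)) ∈ X) →
      (ofBool ((toLat true s).eval β) : α) = ofBool ((toLat true t).eval β))
    (v : ℕ → α) : impEval v s = impEval v t := by
  have e := eval_eq_eval (X := X) (s := toLat true s) (t := toLat true t)
    (List.nodup_dedup (letters s))
    (fun k hk => List.mem_dedup.2 (fst_mem_letters hk))
    (fun k hk => List.mem_dedup.2 (hst ▸ fst_mem_letters hk))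
    (fun β hβ => hag β fun i hi => hβ i (List.mem_dedup.2 hi)) (litVal v) ?_
  · simpa [eval_toLat] using e
  intro i hi
  rw [List.mem_dedup] at hi
  have abs : ∀ {r : FreeMagma ℕ} (p : Bool), (i, p) ∈ (toLat true r).vars →
      (toLat true r).eval (litVal v) ◁ litVal v (i, p) = (toLat true r).eval (litVal v) :=
    fun p h => eval_shift_of_mem _ _ h
  by_cases hc : ComplFibrewise α
  · have habs : ∀ r : FreeMagma ℕ, i ∈ letters r →
        (toLat true r).eval (litVal v) ◁ (v i ⊓ (v i)ᶜ) = (toLat true r).eval (litVal v) := by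
      intro r hr
      obtain ⟨p, hp⟩ := exists_literal_mem (p := true) hr
      have h₁ := abs p hp
      cases p
      · replace h₁ : _ ◁ (v i)ᶜ = _ := h₁
        have := hc (v i)ᶜ
        rw [compl_compl] at this
        rw [DistribBisemilattice.inf_comm, shift_inf, ← shift_shift, this, h₁]
      · replace h₁ : _ ◁ v i = _ := h₁
        rw [shift_inf, ← shift_shift, hc, h₁]
    exact ⟨_, hres i (v i), habs s hi, habs t (hst ▸ hi)⟩
  · have hsame : sameLiterals s t = true := by
      by_contra h
      exact hc (hlit (Bool.eq_false_iff.2 h))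
    have hiff : ∀ k, k ∈ (toLat true s).vars ↔ k ∈ (toLat true t).vars := by
      simp only [sameLiterals, Bool.and_eq_true, List.all_eq_true, List.contains_iff_mem] at hsame
      exact fun k => ⟨hsame.1 k, hsame.2 k⟩
    by_cases hboth : ∀ p, (i, p) ∈ (toLat true s).vars
    · refine ⟨_, hres i (v i), ?_, ?_⟩
      · rw [shift_inf]
        exact (congrArg (· ◁ _) (abs true (hboth true))).trans (abs false (hboth false))
      · rw [shift_inf]
        exact (congrArg (· ◁ _) (abs true ((hiff _).1 (hboth true)))).trans
          (abs false ((hiff _).1 (hboth false)))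
    · obtain ⟨p, hp⟩ := not_forall.1 hboth
      obtain ⟨q, hq⟩ := exists_literal_mem (p := true) hi
      have hpq : p = !q := by cases p <;> cases q <;> simp_all
      subst hpq
      refine ⟨if q then v i else (v i)ᶜ, fun w f h₁ h₂ h => ?_, abs q hq, abs q ((hiff _).1 hq)⟩
      exact resolves_of_not_mem q hp (fun h => hp ((hiff _).2 h)) _ _ w f h₁ h₂
        fun p hp => h p (hX p hp)

theorem impEval_eq_of_holds {s t : FreeMagma ℕ} (hst : letters s = letters t)
    (h4 : ∀ i ∈ letters s, i < 4) (hfull : agree threeValued s t = agree allPairs s t)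
    (h : (profile s t).Holds α) (v : ℕ → α) : impEval v s = impEval v t := by
  obtain ⟨hl, hc, ht⟩ := h
  have agree_of : ∀ {X}, agree X s t = true → (true, false) ∈ X → ∀ β : Literal → Bool,
      (∀ i ∈ letters s, (β (i, true), β (i, false)) ∈ X) →
      (ofBool ((toLat true s).eval β) : α) = ofBool ((toLat true t).eval β) := by
    intro X hX hX' β hβ
    -- the variables that do not occur are given a value from `X`
    let β' : Literal → Bool := fun k => if k.1 ∈ letters s then β k else k.2
    have e := eval_eq_of_agree hX h4 (hst ▸ h4) (β := β') fun i _ => by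
      by_cases hi : i ∈ letters s
      · simpa [β', hi] using hβ i hi
      · simpa [β', hi] using hX'
    have hβ' : ∀ k : Literal, k.1 ∈ letters s → β' k = β k := fun k hk => by simp [β', hk]
    rw [eval_congr _ fun k hk => hβ' k (fst_mem_letters hk),
      eval_congr (toLat true t) fun k hk => hβ' k (hst ▸ fst_mem_letters hk)] at e
    rw [e]
  by_cases hA : agree allPairs s t = true
  · exact impEval_eq_of_resolves hst (X := allPairs) (by decide)
      (fun i a => resolves_allPairs _ _ i a aᶜ) hl (agree_of hA (by decide)) v
  · have hcomp : IsComplemented α := ht (by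
      rw [Bool.not_eq_true] at hA
      exact hfull.trans hA)
    refine impEval_eq_of_resolves hst (X := classical) (fun _ => id)
      (fun i a => resolves_classical _ _ i (hcomp a) (hcomp.inf_compl a)) hl ?_ v
    by_cases hC : agree classical s t = true
    · exact agree_of hC (by decide)
    · have h01 : (0 : α) = 1 := hc (Bool.eq_false_iff.2 hC)
      have : ∀ b : Bool, (ofBool b : α) = 0 := fun b => by cases b <;> simp [ofBool, h01]
      exact fun β _ => by rw [this, this]

end

end DeMorganBisemilattice

open DistribBisemilattice DeMorganBisemilattice LatTerm

/-! ### Symmetric implication zroupoids as bisemilattices -/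

/-- A symmetric implication zroupoid is a bisemilattice with De Morgan involution, with
`x ⊓ y = x ∧ y` and `x ⊔ y = x' → y`. Its identity `(x → y) → z ≈ ((z' → x) → (y → z)')'` says
that `⊔` distributes over `⊓`. -/
abbrev toDeMorgan {A : Zroupoid.{u}} (hA : A ∈ varietyS) : DeMorganBisemilattice A.carrier :=
  have nn : ∀ x, A.neg (A.neg x) = x := hA.2.1
  have hmc : ∀ x y, A.meet x y = A.meet y x := hA.2.2
  have hsup : ∀ x y, A.imp (A.neg x) y = A.neg (A.meet (A.neg x) (A.neg y)) := fun x y => by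
    rw [Zroupoid.meet, nn, nn]
  have hsc : ∀ x y, A.imp (A.neg x) y = A.imp (A.neg y) x := fun x y => by
    rw [hsup, hmc, ← hsup]
  have hsi : ∀ x y z, A.imp (A.neg x) (A.meet y z) =
      A.meet (A.imp (A.neg x) y) (A.imp (A.neg x) z) := fun x y z => by
    rw [hsc, Zroupoid.meet, nn, hA.1.1, hsc x z, Zroupoid.meet]
  have hms : ∀ x y, A.meet x y = A.neg (A.imp (A.neg (A.neg x)) (A.neg y)) := fun x y => by
    rw [nn, Zroupoid.meet]
  have hmn : ∀ x y, A.neg (A.meet x y) = A.imp (A.neg (A.neg x)) (A.neg y) := fun x y => by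
    rw [hms, nn]
  { min := A.meet
    max := fun x y => A.imp (A.neg x) y
    zero := A.zero
    one := A.neg A.zero
    compl := A.neg
    inf_comm := hmc
    sup_comm := hsc
    inf_one := fun x => by
      change A.neg (A.imp x (A.neg (A.neg A.zero))) = x
      rw [nn]
      exact nn x
    sup_zero := nn
    inf_sup := fun x y z => by
      rw [hms x, hsup y z, nn (A.meet _ _), hsi, hsup (A.meet x y), hmn x y, hmn x z]
    sup_inf := hsi
    compl_compl := nn
    compl_sup := fun x y => by
      rw [hsup, nn]
    compl_zero := rfl }

/-- The members of `varietyS` that satisfy the conditions corresponding to a profile. -/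
def profileVariety (P : Profile) : Set Zroupoid.{u} :=
  {A | ∃ hA : A ∈ varietyS, @Profile.Holds P A.carrier (toDeMorgan hA)}

theorem eval_eq_impEval {A : Zroupoid.{u}} (hA : A ∈ varietyS) (v : ℕ → A.carrier)
    (t : FreeMagma ℕ) : A.eval v t = @impEval A.carrier (toDeMorgan hA) v t := by
  induction t using FreeMagma.rec with
  | of i => rfl
  | mul s t hs ht =>
    change A.imp (A.eval v s) (A.eval v t) = A.imp (A.neg (A.neg _)) _
    rw [hA.2.1, hs, ht]

theorem variety_eq_profileVariety {s t : FreeMagma ℕ} (hst : letters s = letters t)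
    (h4 : ∀ i ∈ letters s, i < 4) (hfull : agree threeValued s t = agree allPairs s t) :
    variety.{u} s t = profileVariety (profile s t) := by
  ext A
  refine (exists_prop (a := A ∈ varietyS)).symm.trans (exists_congr fun hA => ?_)
  let _ := toDeMorgan hA
  have e : A.Satisfies s t ↔ ∀ v : ℕ → A.carrier, impEval v s = impEval v t := by
    simp only [Zroupoid.Satisfies, eval_eq_impEval hA]
  rw [e]
  exact ⟨holds_profile, impEval_eq_of_holds hst h4 hfull⟩

theorem profileVariety_eq_varietyS : profileVariety.{u} ⟨true, true, true⟩ = varietyS := by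
  ext A
  exact ⟨fun h => h.1, fun hA => ⟨hA, by simp [Profile.Holds]⟩⟩

/-- With `0 = 1` the two operations coincide, since `x ◁ y` is `x ⊔ 0 ⊓ y = x ⊔ 1 ⊓ y`; if
moreover complements stay in their fibre then they are trivial. -/
theorem profileVariety_eq_varietySL : profileVariety.{u} ⟨false, false, false⟩ = varietySL := by
  ext A
  constructor
  · rintro ⟨hA, hc, h01, -⟩
    let _ := toDeMorgan hA
    replace hc : ∀ x : A.carrier, x ◁ xᶜ = x := hc rfl
    replace h01 : (0 : A.carrier) = 1 := h01 rfl
    have hshift : ∀ x y : A.carrier, x ◁ y = x ⊔ y := fun x y => by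
      rw [shift, h01, one_inf]
    have hneg : ∀ x : A.carrier, xᶜ = x := fun x => by
      have h₁ := hc x
      have h₂ := hc xᶜ
      rw [hshift] at h₁ h₂
      rw [DeMorganBisemilattice.compl_compl, DistribBisemilattice.sup_comm] at h₂
      exact h₂.symm.trans h₁
    have himp : ∀ x y, A.imp x y = A.imp y x := fun x y => by
      have h := DistribBisemilattice.sup_comm x y
      change A.imp (xᶜ) y = A.imp (yᶜ) x at h
      rwa [hneg, hneg] at h
    exact ⟨hA.1, hneg, himp⟩
  · rintro ⟨hI, hneg, himp⟩
    have hA : A ∈ varietyS := ⟨hI, fun x => by rw [hneg, hneg], fun x y => by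
      simp only [Zroupoid.meet, hneg]
      exact himp x y⟩
    let _ := toDeMorgan hA
    have h01 : (0 : A.carrier) = 1 := (hneg A.zero).symm
    refine ⟨hA, fun _ x => ?_, fun _ => h01, fun _ => isComplemented_of_zero_eq_one h01⟩
    have : xᶜ = x := hneg x
    rw [this, shift_self]

/-! ### The six blocks -/

/-- The common profile of the laws of a block. -/
def Block.profile : Block → Profile
  | .sl => ⟨false, false, false⟩
  | .a43A12 => ⟨false, true, false⟩
  | .a43A23 => ⟨true, false, false⟩
  | .a42A12 => ⟨false, true, true⟩
  | .a43F25 => ⟨true, true, false⟩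
  | .s => ⟨true, true, true⟩

theorem Block.profile_injective : Function.Injective Block.profile := by
  intro b c h
  cases b <;> cases c <;> first | rfl | simp [Block.profile] at h

/-- The law with the given name has the profile `P`, and for this law three truth values suffice
to compare the two sides under all assignments to the literals. -/
def hasProfile (P : Profile) (l : LawName) : Bool :=
  match bracketing l.1 l.2.1, bracketing l.1 l.2.2 with
  | some s, some t => (profile s t == P) && (agree threeValued s t == agree allPairs s t)
  | _, _ => false

theorem all_hasProfile (b : Block) : b.members.all (hasProfile b.profile) = true := by
  cases b <;> decide +kernel

theorem letters_of_bracketing {w : List ℕ} {p : ℕ} {s : FreeMagma ℕ}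
    (h : bracketing w p = some s) : letters s = w := by
  unfold bracketing at h
  split at h <;> first | (cases h; rfl) | cases h

theorem lawVariety_eq_variety {l : LawName} {s t : FreeMagma ℕ}
    (hs : bracketing l.1 l.2.1 = some s) (ht : bracketing l.1 l.2.2 = some t) :
    lawVariety.{u} l = variety s t := by
  ext A
  constructor
  · rintro ⟨s', t', hs', ht', h⟩
    rw [hs] at hs'
    rw [ht] at ht'
    cases hs'
    cases ht'
    exact h
  · exact fun h => ⟨s, t, hs, ht, h⟩

/-! ### Alphabetical words -/

instance (w : List ℕ) : Decidable (Alphabetical w) :=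
  inferInstanceAs (Decidable (∀ (i : ℕ) (hi : i < w.length), ∀ a < w[i], a ∈ w.take i))

instance (l : LawName) : Decidable (l ∈ weakLaws) :=
  inferInstanceAs (Decidable (l.1.length ≤ 4 ∧ Alphabetical l.1 ∧ l.2.1 < l.2.2 ∧
    (bracketing l.1 l.2.1).isSome ∧ (bracketing l.1 l.2.2).isSome))

theorem Alphabetical.getElem_le {w : List ℕ} (h : Alphabetical w) (i : ℕ) (hi : i < w.length) :
    w[i] ≤ i := by
  -- the numbers below `w[i]` all occur among the first `i` letters
  have hsub : Finset.range w[i] ⊆ (w.take i).toFinset := fun a ha =>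
    List.mem_toFinset.2 (h i hi a (Finset.mem_range.1 ha))
  have := (Finset.card_le_card hsub).trans (List.toFinset_card_le _)
  simp only [Finset.card_range, List.length_take] at this
  omega

theorem Alphabetical.append_singleton {w : List ℕ} (h : Alphabetical w) {a : ℕ}
    (ha : ∀ b < a, b ∈ w) : Alphabetical (w ++ [a]) := by
  intro i hi b hb
  by_cases hiw : i < w.length
  · rw [List.getElem_append_left hiw] at hb
    rw [List.take_append_of_le_length hiw.le]
    exact h i hiw b hb
  · have hi' : i = w.length := by
      simp only [List.length_append, List.length_singleton] at hi
      omega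
    subst hi'
    rw [List.getElem_concat_length rfl] at hb
    simpa using ha b hb

/-- Every word becomes alphabetical after an injective renaming of its letters. -/
theorem exists_alphabetical_map (w : List ℕ) :
    ∃ f : ℕ → ℕ, Set.InjOn f {a | a ∈ w} ∧ Alphabetical (w.map f) ∧
      ∃ m, ∀ j, j ∈ w.map f ↔ j < m := by
  induction w using List.reverseRecOn with
  | nil => exact ⟨id, by simp, fun i hi => absurd hi (Nat.not_lt_zero i), 0, by simp⟩
  | append_singleton w a ih =>
    obtain ⟨f, hf, hw, m, hm⟩ := ih
    by_cases ha : a ∈ w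
    · have hset : {b | b ∈ w ++ [a]} = {b | b ∈ w} := by
        ext b
        simp only [List.mem_append, List.mem_singleton, Set.mem_ofPred_eq]
        exact ⟨fun h => h.elim id (fun h => h ▸ ha), Or.inl⟩
      have hfa := (hm _).1 (List.mem_map_of_mem (f := f) ha)
      refine ⟨f, hset ▸ hf, ?_, m, fun j => ?_⟩
      · rw [List.map_append]
        exact hw.append_singleton fun b hb => (hm b).2 (hb.trans hfa)
      · rw [List.map_append, List.mem_append, hm, List.map_singleton, List.mem_singleton]
        exact ⟨fun h => h.elim id (fun h => h ▸ hfa), Or.inl⟩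
    · have hne : ∀ b ∈ w, Function.update f a m b = f b := fun b hb =>
        Function.update_of_ne (fun h => ha (by rwa [h] at hb)) _ _
      have hmap : w.map (Function.update f a m) = w.map f := List.map_congr_left hne
      refine ⟨Function.update f a m, ?_, ?_, m + 1, fun j => ?_⟩
      · have hlt : ∀ b ∈ w, f b < m := fun b hb => (hm _).1 (List.mem_map_of_mem hb)
        intro b hb c hc hbc
        simp only [List.mem_append, List.mem_singleton, Set.mem_ofPred_eq] at hb hc
        rcases hb with hb | rfl <;> rcases hc with hc | rfl
        · rw [hne b hb, hne c hc] at hbc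
          exact hf hb hc hbc
        · rw [hne b hb, Function.update_self] at hbc
          exact absurd hbc (hlt b hb).ne
        · rw [hne c hc, Function.update_self] at hbc
          exact absurd hbc.symm (hlt c hc).ne
        · rfl
      · rw [List.map_append, hmap, List.map_singleton, Function.update_self]
        exact hw.append_singleton fun b hb => (hm b).2 hb
      · rw [List.map_append, hmap, List.mem_append, hm, List.map_singleton, Function.update_self,
          List.mem_singleton]
        omega

/-! ### The list of all laws -/

/-- The laws of all blocks. -/
def allLaws : List LawName :=
  Block.sl.members ++ Block.a43A12.members ++ Block.a43A23.members ++ Block.a42A12.members ++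
    Block.a43F25.members ++ Block.s.members

theorem mem_allLaws {l : LawName} : l ∈ allLaws ↔ ∃ b : Block, l ∈ b.members := by
  simp only [allLaws, List.mem_append]
  constructor
  · rintro (((((h | h) | h) | h) | h) | h) <;> exact ⟨_, h⟩
  · rintro ⟨b, h⟩
    cases b <;> simp [h]

theorem mem_weakLaws_of_mem_allLaws : ∀ l ∈ allLaws, l ∈ weakLaws := by decide +kernel

theorem bracketing_lt {w : List ℕ} {p : ℕ} (h : (bracketing w p).isSome) : p < 6 := by
  unfold bracketing at h
  split at h <;> first | omega | cases h

theorem mem_allLaws_of_mem_weakLaws {l : LawName} (h : l ∈ weakLaws) : l ∈ allLaws := by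
  have h₃ : ∀ (b : Fin 2) (c : Fin 3) (p q : Fin 6),
      (([0, b, c], p, q) : LawName) ∈ weakLaws → (([0, b, c], p, q) : LawName) ∈ allLaws := by
    decide +kernel
  have h₄ : ∀ (b : Fin 2) (c : Fin 3) (d : Fin 4) (p q : Fin 6),
      (([0, b, c, d], p, q) : LawName) ∈ weakLaws →
        (([0, b, c, d], p, q) : LawName) ∈ allLaws := by
    decide +kernel
  obtain ⟨w, p, q⟩ := l
  obtain ⟨hlen, halph, hpq, hp, hq⟩ : w.length ≤ 4 ∧ Alphabetical w ∧ p < q ∧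
    (bracketing w p).isSome ∧ (bracketing w q).isSome := h
  have hle := halph.getElem_le
  have hp' := bracketing_lt hp
  have hq' := bracketing_lt hq
  -- words of length at most `2` have a single bracketing
  have short : ∀ {v : List ℕ} {r : ℕ}, v.length ≤ 2 → (bracketing v r).isSome → r = 1 := by
    intro v r hv hr
    unfold bracketing at hr
    split at hr <;> simp_all
  match w with
  | [] | [_] | [_, _] =>
    have h₁ := short (by simp) hp
    have h₂ := short (by simp) hq
    omega
  | [a, b, c] =>
    obtain rfl : a = 0 := Nat.le_zero.1 (hle 0 (by simp))
    exact h₃ ⟨b, Nat.lt_succ_of_le (hle 1 (by simp))⟩ ⟨c, Nat.lt_succ_of_le (hle 2 (by simp))⟩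
      ⟨p, hp'⟩ ⟨q, hq'⟩ ⟨hlen, halph, hpq, hp, hq⟩
  | [a, b, c, d] =>
    obtain rfl : a = 0 := Nat.le_zero.1 (hle 0 (by simp))
    exact h₄ ⟨b, Nat.lt_succ_of_le (hle 1 (by simp))⟩ ⟨c, Nat.lt_succ_of_le (hle 2 (by simp))⟩
      ⟨d, Nat.lt_succ_of_le (hle 3 (by simp))⟩ ⟨p, hp'⟩ ⟨q, hq'⟩ ⟨hlen, halph, hpq, hp, hq⟩
  | _ :: _ :: _ :: _ :: _ :: _ => simp at hlen; omega

theorem mem_weakLaws_iff {l : LawName} : l ∈ weakLaws ↔ ∃ b : Block, l ∈ b.members :=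
  ⟨fun h => mem_allLaws.1 (mem_allLaws_of_mem_weakLaws h),
    fun h => mem_weakLaws_of_mem_allLaws l (mem_allLaws.2 h)⟩

theorem ncard_weakLaws : weakLaws.ncard = 155 := by
  have e : weakLaws = (allLaws.toFinset : Set LawName) := by
    ext l
    rw [List.coe_toFinset]
    exact ⟨mem_allLaws_of_mem_weakLaws, mem_weakLaws_of_mem_allLaws l⟩
  have hn : allLaws.Nodup := by decide +kernel
  rw [e, Set.ncard_coe_finset, List.toFinset_card_of_nodup hn]
  decide +kernel

theorem exists_profile_eq {b : Block} {l : LawName} (h : l ∈ b.members) :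
    ∃ s t, bracketing l.1 l.2.1 = some s ∧ bracketing l.1 l.2.2 = some t ∧
      profile s t = b.profile ∧ agree threeValued s t = agree allPairs s t := by
  have := List.all_eq_true.1 (all_hasProfile b) l h
  unfold hasProfile at this
  split at this
  · next s t hs ht =>
    rw [Bool.and_eq_true, beq_iff_eq, beq_iff_eq] at this
    exact ⟨s, t, hs, ht, this⟩
  · cases this

theorem block_unique {b c : Block} {l : LawName} (hb : l ∈ b.members) (hc : l ∈ c.members) :
    b = c := by
  obtain ⟨s, t, hs, ht, h, -⟩ := exists_profile_eq hb
  obtain ⟨s', t', hs', ht', h', -⟩ := exists_profile_eq hc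
  rw [hs] at hs'
  rw [ht] at ht'
  cases hs'
  cases ht'
  exact Block.profile_injective (h.symm.trans h')

theorem lawVariety_eq_profileVariety {b : Block} {l : LawName} (h : l ∈ b.members) :
    lawVariety.{u} l = profileVariety b.profile := by
  obtain ⟨s, t, hs, ht, hst, hfull⟩ := exists_profile_eq h
  have hl := letters_of_bracketing hs
  obtain ⟨hlen, halph, -⟩ := mem_weakLaws_iff.2 ⟨b, h⟩
  rw [lawVariety_eq_variety hs ht, ← hst]
  refine variety_eq_profileVariety (hl.trans (letters_of_bracketing ht).symm) ?_ hfull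
  rw [hl]
  intro i hi
  obtain ⟨j, hj, rfl⟩ := List.getElem_of_mem hi
  exact (halph.getElem_le j hj).trans_lt (hj.trans_le hlen)

theorem rep_eq_profileVariety (b : Block) : b.rep = profileVariety.{u} b.profile := by
  cases b with
  | sl => exact profileVariety_eq_varietySL.symm
  | s => exact profileVariety_eq_varietyS.symm
  | _ =>
    refine lawVariety_eq_profileVariety ?_
    decide

theorem lawVariety_eq_rep {b : Block} {l : LawName} (h : l ∈ b.members) :
    lawVariety.{u} l = b.rep := by
  rw [lawVariety_eq_profileVariety h, rep_eq_profileVariety]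

/-! ### Arbitrary weak associative laws -/

theorem eval_map (A : Zroupoid.{u}) (v : ℕ → A.carrier) (f : ℕ → ℕ) (s : FreeMagma ℕ) :
    A.eval v (FreeMagma.map f s) = A.eval (v ∘ f) s := by
  induction s using FreeMagma.rec with
  | of i => rfl
  | mul s t hs ht => exact congrArg₂ A.imp hs ht

theorem letters_map (f : ℕ → ℕ) (s : FreeMagma ℕ) :
    letters (FreeMagma.map f s) = (letters s).map f := by
  induction s using FreeMagma.rec with
  | of i => rfl
  | mul s t hs ht => exact (congrArg₂ _ hs ht).trans List.map_append.symm

theorem eval_congr_letters (A : Zroupoid.{u}) {v w : ℕ → A.carrier} (s : FreeMagma ℕ)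
    (h : ∀ i ∈ letters s, v i = w i) : A.eval v s = A.eval w s := by
  induction s using FreeMagma.rec with
  | of i => exact h i (List.mem_singleton_self i)
  | mul s t hs ht =>
    exact congrArg₂ A.imp (hs fun i hi => h i (List.mem_append_left _ hi))
      (ht fun i hi => h i (List.mem_append_right _ hi))

theorem variety_map {s t : FreeMagma ℕ} (hst : letters s = letters t) {f : ℕ → ℕ}
    (hf : Set.InjOn f {a | a ∈ letters s}) :
    variety.{u} (FreeMagma.map f s) (FreeMagma.map f t) = variety s t := by
  ext A
  refine and_congr_right fun _ => ⟨fun h v => ?_, fun h v => ?_⟩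
  · have hinv : ∀ i ∈ letters s,
        ((v ∘ Function.invFunOn f {a | a ∈ letters s}) ∘ f) i = v i := fun i hi =>
      congrArg v (hf.leftInvOn_invFunOn hi)
    have e := h (v ∘ Function.invFunOn f {a | a ∈ letters s})
    rw [eval_map, eval_map] at e
    rwa [eval_congr_letters A s hinv,
      eval_congr_letters A t fun i hi => hinv i (hst.symm ▸ hi)] at e
  · rw [eval_map, eval_map]
    exact h _

theorem variety_comm (s t : FreeMagma ℕ) : variety.{u} s t = variety t s := by
  ext A
  exact and_congr_right fun _ => forall_congr' fun v => eq_comm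

theorem letters_length_pos (s : FreeMagma ℕ) : 0 < (letters s).length := by
  induction s using FreeMagma.rec with
  | of i => exact Nat.one_pos
  | mul s t hs ht =>
    rw [letters, List.length_append]
    omega

/-- Every term of length at most `4` arises from its word by one of the numbered bracketings. -/
theorem exists_bracketing (s : FreeMagma ℕ) (h : (letters s).length ≤ 4) :
    ∃ p, bracketing (letters s) p = some s := by
  have len₁ : ∀ r : FreeMagma ℕ, (letters r).length = 1 → ∃ a, r = .of a := by
    rintro (a | ⟨x, y⟩) hr
    · exact ⟨a, rfl⟩
    · have := letters_length_pos x
      have := letters_length_pos y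
      rw [letters, List.length_append] at hr
      omega
  have len₂ : ∀ r : FreeMagma ℕ, (letters r).length = 2 → ∃ a b, r = .mul (.of a) (.of b) := by
    rintro (a | ⟨x, y⟩) hr
    · cases hr
    · have := letters_length_pos x
      have := letters_length_pos y
      rw [letters, List.length_append] at hr
      obtain ⟨a, rfl⟩ := len₁ x (by omega)
      obtain ⟨b, rfl⟩ := len₁ y (by omega)
      exact ⟨a, b, rfl⟩
  have len₃ : ∀ r : FreeMagma ℕ, (letters r).length = 3 →
      ∃ a b c, r = .mul (.of a) (.mul (.of b) (.of c)) ∨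
        r = .mul (.mul (.of a) (.of b)) (.of c) := by
    rintro (a | ⟨x, y⟩) hr
    · cases hr
    · have := letters_length_pos x
      have := letters_length_pos y
      rw [letters, List.length_append] at hr
      obtain hx | hx : (letters x).length = 1 ∨ (letters x).length = 2 := by omega
      · obtain ⟨a, rfl⟩ := len₁ x hx
        obtain ⟨b, c, rfl⟩ := len₂ y (by omega)
        exact ⟨a, b, c, Or.inl rfl⟩
      · obtain ⟨a, b, rfl⟩ := len₂ x hx
        obtain ⟨c, rfl⟩ := len₁ y (by omega)
        exact ⟨a, b, c, Or.inr rfl⟩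
  have := letters_length_pos s
  obtain hs | hs | hs | hs : (letters s).length = 1 ∨ (letters s).length = 2 ∨
      (letters s).length = 3 ∨ (letters s).length = 4 := by omega
  · obtain ⟨a, rfl⟩ := len₁ s hs
    exact ⟨1, rfl⟩
  · obtain ⟨a, b, rfl⟩ := len₂ s hs
    exact ⟨1, rfl⟩
  · obtain ⟨a, b, c, rfl | rfl⟩ := len₃ s hs
    · exact ⟨1, rfl⟩
    · exact ⟨2, rfl⟩
  · obtain a | ⟨x, y⟩ := s
    · cases hs
    have := letters_length_pos x
    have := letters_length_pos y
    rw [letters, List.length_append] at hs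
    obtain hx | hx | hx : (letters x).length = 1 ∨ (letters x).length = 2 ∨
      (letters x).length = 3 := by omega
    · obtain ⟨a, rfl⟩ := len₁ x hx
      obtain ⟨b, c, d, rfl | rfl⟩ := len₃ y (by omega)
      · exact ⟨1, rfl⟩
      · exact ⟨2, rfl⟩
    · obtain ⟨a, b, rfl⟩ := len₂ x hx
      obtain ⟨c, d, rfl⟩ := len₂ y (by omega)
      exact ⟨3, rfl⟩
    · obtain ⟨a, b, c, rfl | rfl⟩ := len₃ x hx <;> obtain ⟨d, rfl⟩ := len₁ y (by omega)
      · exact ⟨4, rfl⟩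
      · exact ⟨5, rfl⟩

theorem exists_variety_eq_rep {s t : FreeMagma ℕ} (hst : letters s = letters t)
    (hlen : (letters s).length ≤ 4) : ∃ b : Block, variety.{u} s t = b.rep := by
  obtain ⟨f, hf, halph, -⟩ := exists_alphabetical_map (letters s)
  rw [← variety_map hst hf]
  rw [← letters_map] at halph
  have hst' : letters (FreeMagma.map f s) = letters (FreeMagma.map f t) := by
    rw [letters_map, letters_map, hst]
  have hlen' : (letters (FreeMagma.map f s)).length ≤ 4 := by
    rwa [letters_map, List.length_map]
  generalize FreeMagma.map f s = s' at *
  generalize FreeMagma.map f t = t' at *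
  obtain ⟨p, hp⟩ := exists_bracketing s' hlen'
  obtain ⟨q, hq⟩ := exists_bracketing t' (hst' ▸ hlen')
  rw [← hst'] at hq
  have hp' : (bracketing (letters s') p).isSome := by rw [hp]; rfl
  have hq' : (bracketing (letters s') q).isSome := by rw [hq]; rfl
  rcases lt_trichotomy p q with h | rfl | h
  · obtain ⟨b, hb⟩ := mem_weakLaws_iff.1
      (show (letters s', p, q) ∈ weakLaws from ⟨hlen', halph, h, hp', hq'⟩)
    exact ⟨b, (lawVariety_eq_variety hp hq).symm.trans (lawVariety_eq_rep hb)⟩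
  · rw [hp] at hq
    cases hq
    refine ⟨.s, ?_⟩
    ext A
    exact and_iff_left fun v => rfl
  · obtain ⟨b, hb⟩ := mem_weakLaws_iff.1
      (show (letters s', q, p) ∈ weakLaws from ⟨hlen', halph, h, hq', hp'⟩)
    exact ⟨b, (variety_comm _ _).trans
      ((lawVariety_eq_variety hq hp).symm.trans (lawVariety_eq_rep hb))⟩

end WeakAssoc

theorem proposition8p1 :
    -- every weak associative law of length at most 4 defines one of the six varieties
    (∀ n : ℕ, n ≤ 4 → ∀ s t : FreeMagma ℕ, WeakAssoc.IsWeakAssocLaw n s t →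
      WeakAssoc.variety.{u} s t ∈
        ({WeakAssoc.varietySL.{u},
          WeakAssoc.lawVariety.{u} (WeakAssoc.w43A, 1, 2),
          WeakAssoc.lawVariety.{u} (WeakAssoc.w43A, 2, 3),
          WeakAssoc.lawVariety.{u} (WeakAssoc.w42A, 1, 2),
          WeakAssoc.lawVariety.{u} (WeakAssoc.w43F, 2, 5),
          WeakAssoc.varietyS.{u}} : Set (Set WeakAssoc.Zroupoid.{u}))) ∧
    -- there are 155 nontrivial ones, up to renaming the variables and swapping the two sides
    WeakAssoc.weakLaws.ncard = 155 ∧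
    -- the explicit blocks partition them
    (∀ l : WeakAssoc.LawName,
      l ∈ WeakAssoc.weakLaws ↔ ∃! b : WeakAssoc.Block, l ∈ b.members) ∧
    -- every law of a block defines the variety that represents the block
    (∀ b : WeakAssoc.Block, ∀ l ∈ b.members,
      WeakAssoc.lawVariety.{u} l = WeakAssoc.Block.rep.{u} b) := by
  refine ⟨?_, WeakAssoc.ncard_weakLaws, fun l => ?_, fun b l hl => WeakAssoc.lawVariety_eq_rep hl⟩
  · rintro n hn s t ⟨hlen, hst⟩
    obtain ⟨b, hb⟩ := WeakAssoc.exists_variety_eq_rep hst (hlen.trans_le hn)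
    rw [hb]
    cases b <;> simp [WeakAssoc.Block.rep]
  · rw [WeakAssoc.mem_weakLaws_iff]
    exact ⟨fun ⟨b, hb⟩ => ⟨b, hb, fun c hc => WeakAssoc.block_unique hc hb⟩,
      fun ⟨b, hb, _⟩ => ⟨b, hb⟩⟩
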